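/- Let $\mathcal P=(\mathcal P,d,\mu)$ be a metric space with a Borel regular doubling measure $\mu$: every ball $B(x,r)=\{y:d(y,x)<r\}$, $r>0$, has positive and finite measure and $\mu(B(x,2r))\le c_d\,\mu(B(x,r))$ with a constant $c_d$ independent of $x\in\mathcal P$ and $r>0$. Let $L^0$ be the set of measurable, almost everywhere finite functions $\mathcal P\to[-\infty,\infty]$. A *quasi-Banach function space* over $\mathcal P$ is a linear subspace $X\subset L^0$ with a complete quasinorm $\|\cdot\|_X$ (so $\|f\|_X=0$ iff $f=0$ a.e.; $\|\alpha f\|_X=|\alpha|\|f\|_X$ for $\alpha\in\mathbb R$; $\|f+g\|_X\le c_\Delta(\|f\|_X+\|g\|_X)$) such that, with $\|f\|_X=\infty$ for $f\notin X$: (i) if $f$ is measurable, $g\in X$ and $|f|\le|g|$ a.e., then $f\in X$ and $\|f\|_X\le\|g\|_X$; (ii) $\|\chi_E\|_X<\infty$ for every measurable $E$ with $\mu(E)<\infty$; (iii) if $0\le f_k\uparrow f$ a.e., then $\|f_k\|_X\uparrow\|f\|_X$. The quasinorm is *absolutely continuous* if $\|f\chi_{E_k}\|_X\to0$ whenever $f\in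 X$ and $(E_k)$ is a decreasing sequence of measurable sets with $\bigcap_kE_k=\emptyset$. For $0<\gamma<1$, measurable $u:\mathcal P\to[-\infty,\infty]$ and $A\subset\mathcal P$ of finite measure put $$m_u^\gamma(A)=\inf\{a\in\mathbb R:\mu(\{x\in A:u(x)>a\})<\gamma\mu(A)\},\qquad \mathcal M^\gamma_1u(x)=\sup_{0<r<1}m^\gamma_{|u|}(B(x,r)).$$ Let $0<s\le1$. A measurable $g:\mathcal P\to[0,\infty]$ is an *$s$-gradient* of $u\in L^0$ if $|u(x)-u(y)|\le d(x,y)^s(g(x)+g(y))$ for all $x,y$ outside a set of measure zero. Let $\|u\|_{\dot M^{s,X}}=\inf\|g\|_X$ over all $s$-gradients $g$ of $u$, let $\dot M^{s,X}$ be the set of $u\in L^0$ with $\|u\|_{\dot M^{s,X}}<\infty$, and let $M^{s,X}=\dot M^{s,X}\cap X$ with $\|u\|_{M^{s,X}}=\|u\|_X+\|u\|_{\dot M^{s,X}}$. The *capacity* of $E\subset\mathcal P$ is $$C_{M^{s,X}}(E)=\inf\{\|u\|_{M^{s,X}}:u\in M^{s,X},\ u\ge1\text{ on a neighbourhood of }E\}.$$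 A function $u:\mathcal P\to[-\infty,\infty]$ is *quasicontinuous* if for every $\varepsilon>0$ there is a set $E$ with $C_{M^{s,X}}(E)<\varepsilon$ such that the restriction of $u$ to $\mathcal P\setminus E$ is continuous. **Theorem.** Suppose that $X$ has absolutely continuous quasinorm and that, for every $0<\gamma<1$ and every ball $B\subset\mathcal P$, there is a constant $C$ such that $$\|(\mathcal M^\gamma_1g)\chi_B\|_X\le C\|g\|_X\quad\text{for every }g\in X.$$ Let $0<s\le1$. Then for every quasicontinuous $u\in\dot M^{s,X}$ there is a set $E\subset\mathcal P$ with $C_{M^{s,X}}(E)=0$ such that, for every $x\in\mathcal P\setminus E$ and every $0<\gamma<1$, $$\lim_{r\to0}m^\gamma_{|u-u(x)|}(B(x,r))=0\qquad\text{and}\qquad\lim_{r\to0}m^\gamma_u(B(x,r))=u(x).$$ -/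

import Mathlib

open MeasureTheory Filter Topology Set
open scoped ENNReal NNReal

/-- A doubling measure on a metric space, at all scales and for open balls, every ball having
positive and finite measure. (Mathlib's `IsUnifLocDoublingMeasure` only concerns small scales.) -/
structure IsDoublingMeasure {P : Type*} [MetricSpace P] [MeasurableSpace P]
    (μ : Measure P) : Prop where
  ball_pos : ∀ (x : P) (r : ℝ), 0 < r → 0 < μ (Metric.ball x r)
  ball_lt_top : ∀ (x : P) (r : ℝ), 0 < r → μ (Metric.ball x r) < ∞
  doubling : ∃ c : ℝ≥0, ∀ (x : P) (r : ℝ), 0 < r →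
    μ (Metric.ball x (2 * r)) ≤ c * μ (Metric.ball x r)

/-- `L⁰`: the `μ`-measurable (that is, measurable for the completion of `μ`), almost everywhere
finite functions with values in `[-∞, ∞]`. -/
def IsL0 {P : Type*} [MeasurableSpace P] (μ : Measure P) (f : P → EReal) : Prop :=
  AEMeasurable f μ ∧ ∀ᵐ x ∂μ, f x ≠ ⊤ ∧ f x ≠ ⊥

/-- A quasi-Banach function space `X` over `(P, μ)`. The quasinorm is given on all functions
`P → [-∞, ∞]`, with the convention that it is `∞` outside `X`; so `X` is the set of functions of
finite quasinorm, and it is contained in `L⁰`. Sums and multiples of functions in `X` are taken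
pointwise (they are well defined almost everywhere). -/
structure QuasiBanachFunctionSpace {P : Type*} [MeasurableSpace P] (μ : Measure P) where
  /-- the quasinorm, `∞` outside the space -/
  qnorm : (P → EReal) → ℝ≥0∞
  isL0_of_lt_top : ∀ f, qnorm f < ∞ → IsL0 μ f
  qnorm_eq_zero_iff : ∀ f, qnorm f = 0 ↔ ∀ᵐ x ∂μ, f x = 0
  qnorm_smul : ∀ (a : ℝ) (f : P → EReal), qnorm f < ∞ →
    qnorm (fun x => (a : EReal) * f x) = ENNReal.ofReal |a| * qnorm f
  qnorm_add_le : ∃ c : ℝ≥0, ∀ f g : P → EReal, qnorm f < ∞ → qnorm g < ∞ →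
    qnorm (fun x => f x + g x) ≤ c * (qnorm f + qnorm g)
  complete : ∀ f : ℕ → P → EReal, (∀ n, qnorm (f n) < ∞) →
    (∀ ε : ℝ≥0∞, 0 < ε → ∃ N, ∀ m ≥ N, ∀ n ≥ N, qnorm (fun x => f m x - f n x) < ε) →
    ∃ g, qnorm g < ∞ ∧ Tendsto (fun n => qnorm (fun x => f n x - g x)) atTop (𝓝 0)
  /-- the lattice (ideal) property -/
  qnorm_mono : ∀ f g : P → EReal, IsL0 μ f → qnorm g < ∞ →
    (∀ᵐ x ∂μ, (f x).abs ≤ (g x).abs) → qnorm f ≤ qnorm g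
  qnorm_indicator_lt_top : ∀ E : Set P, NullMeasurableSet E μ → μ E < ∞ →
    qnorm (E.indicator fun _ => 1) < ∞
  /-- the Fatou property: `0 ≤ fₖ ↑ f` a.e. implies `‖fₖ‖ ↑ ‖f‖` -/
  qnorm_tendsto : ∀ (f : ℕ → P → EReal) (g : P → EReal), (∀ k, IsL0 μ (f k)) → IsL0 μ g →
    (∀ᵐ x ∂μ, (∀ k, 0 ≤ f k x) ∧ Monotone (fun k => f k x) ∧
      Tendsto (fun k => f k x) atTop (𝓝 (g x))) →
    Tendsto (fun k => qnorm (f k)) atTop (𝓝 (qnorm g))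

/-- The quasinorm of `X` is absolutely continuous. -/
def QuasiBanachFunctionSpace.AbsolutelyContinuous {P : Type*} [MeasurableSpace P]
    {μ : Measure P} (X : QuasiBanachFunctionSpace μ) : Prop :=
  ∀ f : P → EReal, X.qnorm f < ∞ → ∀ E : ℕ → Set P, (∀ k, NullMeasurableSet (E k) μ) →
    Antitone E → (⋂ k, E k) = ∅ →
    Tendsto (fun k => X.qnorm ((E k).indicator f)) atTop (𝓝 0)

/-- The `γ`-median `m_u^γ(A) = inf {a ∈ ℝ : μ {x ∈ A : u x > a} < γ μ(A)}`, an infimum in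
`[-∞, ∞]`. -/
noncomputable def gammaMedian {P : Type*} [MeasurableSpace P] (μ : Measure P) (γ : ℝ)
    (u : P → EReal) (A : Set P) : EReal :=
  sInf ((fun a : ℝ => (a : EReal)) ''
    {a : ℝ | μ {x | x ∈ A ∧ (a : EReal) < u x} < ENNReal.ofReal γ * μ A})

/-- The restricted `γ`-median maximal function
`M^γ_R u(x) = sup_{0 < r < R} m^γ_{|u|}(B(x, r))`. -/
noncomputable def medianMaximal {P : Type*} [MetricSpace P] [MeasurableSpace P] (μ : Measure P)
    (γ R : ℝ) (u : P → EReal) (x : P) : EReal :=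
  ⨆ (r : ℝ) (_ : 0 < r ∧ r < R), gammaMedian μ γ (fun y => ((u y).abs : EReal)) (Metric.ball x r)

/-- `g : P → [0, ∞]` is an `s`-gradient of `u`. -/
def IsSGradient {P : Type*} [MetricSpace P] [MeasurableSpace P] (μ : Measure P) (s : ℝ)
    (u : P → EReal) (g : P → ℝ≥0∞) : Prop :=
  AEMeasurable g μ ∧ ∃ E : Set P, μ E = 0 ∧ ∀ x ∉ E, ∀ y ∉ E,
    (u x - u y).abs ≤ ENNReal.ofReal (dist x y ^ s) * (g x + g y)

/-- The homogeneous Hajłasz seminorm `inf {‖g‖_X : g an s-gradient of u}`. -/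
noncomputable def homHajlaszNorm {P : Type*} [MetricSpace P] [MeasurableSpace P] {μ : Measure P}
    (X : QuasiBanachFunctionSpace μ) (s : ℝ) (u : P → EReal) : ℝ≥0∞ :=
  ⨅ (g : P → ℝ≥0∞) (_ : IsSGradient μ s u g), X.qnorm fun x => (g x : EReal)

/-- Membership in the homogeneous Hajłasz space `Ṁ^{s,X}`. -/
def MemHomHajlasz {P : Type*} [MetricSpace P] [MeasurableSpace P] {μ : Measure P}
    (X : QuasiBanachFunctionSpace μ) (s : ℝ) (u : P → EReal) : Prop :=
  IsL0 μ u ∧ homHajlaszNorm X s u < ∞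

/-- The norm of the Hajłasz space `M^{s,X}`. -/
noncomputable def hajlaszNorm {P : Type*} [MetricSpace P] [MeasurableSpace P] {μ : Measure P}
    (X : QuasiBanachFunctionSpace μ) (s : ℝ) (u : P → EReal) : ℝ≥0∞ :=
  X.qnorm u + homHajlaszNorm X s u

/-- Membership in the Hajłasz space `M^{s,X} = Ṁ^{s,X} ∩ X`. -/
def MemHajlasz {P : Type*} [MetricSpace P] [MeasurableSpace P] {μ : Measure P}
    (X : QuasiBanachFunctionSpace μ) (s : ℝ) (u : P → EReal) : Prop :=
  MemHomHajlasz X s u ∧ X.qnorm u < ∞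

/-- The `M^{s,X}`-capacity of a set: the infimum of the norms of the functions in `M^{s,X}` that
are at least `1` on a neighbourhood of the set (`∞` if there are none). -/
noncomputable def hajlaszCapacity {P : Type*} [MetricSpace P] [MeasurableSpace P] {μ : Measure P}
    (X : QuasiBanachFunctionSpace μ) (s : ℝ) (E : Set P) : ℝ≥0∞ :=
  ⨅ (u : P → EReal) (_ : MemHajlasz X s u ∧ ∃ U : Set P, IsOpen U ∧ E ⊆ U ∧ ∀ x ∈ U, 1 ≤ u x),
    hajlaszNorm X s u

/-- Quasicontinuity with respect to the `M^{s,X}`-capacity. -/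
def IsQuasicontinuous {P : Type*} [MetricSpace P] [MeasurableSpace P] {μ : Measure P}
    (X : QuasiBanachFunctionSpace μ) (s : ℝ) (u : P → EReal) : Prop :=
  ∀ ε : ℝ≥0∞, 0 < ε → ∃ E : Set P, hajlaszCapacity X s E < ε ∧ ContinuousOn u Eᶜ

/-!
Quasicontinuity alone gives the limits at most points. Let `E` have small capacity and let `u` be
continuous off `E`; the capacity provides an open set `U ⊇ E` and a test function `T` of small norm
with `T ≥ 1` on `U`. If `U` fills less than the portion `γ` of every small ball centred at `x`, then
by continuity off `U` every set `{|u - u x| > a}` fills less than `γ` of the small balls, and the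
`γ`-median of `|u - u x|` tends to `0` (`smallDeviation_of_continuousOn`). The convergence of the
medians of `u` follows by using this for both `γ` and `1 - γ`.

It remains to see that the set of the other points has small capacity. This is the weak type
estimate `exists_hajlaszCapacity_portion_le`: the centres of the small balls that `U` fills in the
portion `γ` form, locally, a set of capacity at most a multiple of the norm of `T`. Its test
function is a maximal function of `f = min T 1`, built from the upper quantiles of `f` over balls.
The quantiles over balls of one radius `ρ` are made into a function with slopes by taking a supremum
of cones, cut off at distance `ρ`; the slope of each cone is chosen so that cutting it off creates
no jump in the supremum. If `g` is a gradient of `f`, quantiles over neighbouring balls differ by at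
most a multiple of `ρ ^ s` times a median of `g`, so `g` plus the median maximal function of `g` is,
up to a constant, a gradient (`quantileMaximal_le_quantileMaximal_add`). The hypothesis on the
median maximal operator bounds its norm on balls, and a cutoff function localizes the estimate. No
averages are used, as `g` need not be locally integrable.

The points where `u` is infinite are handled separately (`hajlaszCapacity_setOf_abs_eq_top`): off
`U` they have a neighbourhood on which `|u|` is large, so a small multiple of `|u|`, cut off to a
ball, plus `T` is a test function. Countable unions of sets of capacity zero have capacity zero by
the countable quasi-triangle inequality `QuasiBanachFunctionSpace.posNorm_tsum_le`.
-/

/-! ### The quasinorm on nonnegative functions -/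

theorem EReal.measurable_abs : Measurable EReal.abs :=
  EReal.measurable_of_measurable_real
    (ENNReal.measurable_ofReal.comp measurable_norm)

theorem EReal.abs_coe_ennreal (a : ℝ≥0∞) : (a : EReal).abs = a := by
  induction a with
  | top => simp
  | coe a =>
    rw [EReal.coe_nnreal_eq_coe_real, EReal.abs_def]
    simp

theorem EReal.abs_ne_top_iff {a : EReal} : a.abs ≠ ⊤ ↔ a ≠ ⊤ ∧ a ≠ ⊥ := by
  induction a with
  | bot => simp
  | top => simp
  | coe a => simp [EReal.abs_def]

theorem EReal.le_coe_abs (a : EReal) : a ≤ (a.abs : EReal) := by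
  induction a with
  | bot => simp
  | top => simp
  | coe a => rw [EReal.coe_abs]; exact_mod_cast le_abs_self a

theorem isL0_coe_iff {P : Type*} [MeasurableSpace P] {μ : Measure P} {f : P → ℝ≥0∞} :
    IsL0 μ (fun x => (f x : EReal)) ↔ AEMeasurable f μ ∧ ∀ᵐ x ∂μ, f x ≠ ⊤ := by
  constructor
  · rintro ⟨h1, h2⟩
    refine ⟨?_, ?_⟩
    · refine (EReal.measurable_abs.comp_aemeasurable h1).congr (Eventually.of_forall fun x => ?_)
      exact EReal.abs_coe_ennreal _
    · filter_upwards [h2] with x hx h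
      exact hx.1 (by simp [h])
  · rintro ⟨h1, h2⟩
    refine ⟨measurable_coe_ennreal_ereal.comp_aemeasurable h1, ?_⟩
    filter_upwards [h2] with x hx
    exact ⟨by simpa using hx, by simp⟩

namespace QuasiBanachFunctionSpace

variable {P : Type*} [MeasurableSpace P] {μ : Measure P} (X : QuasiBanachFunctionSpace μ)

/-- The quasinorm of a nonnegative function. For such functions sums, multiples and suprema are
unproblematic, so all the norm estimates are made with it. -/
noncomputable def posNorm (f : P → ℝ≥0∞) : ℝ≥0∞ := X.qnorm fun x => (f x : EReal)

variable {X}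

theorem isL0_of_posNorm_lt_top {f : P → ℝ≥0∞} (h : X.posNorm f < ∞) :
    AEMeasurable f μ ∧ ∀ᵐ x ∂μ, f x ≠ ⊤ :=
  isL0_coe_iff.1 (X.isL0_of_lt_top _ h)

theorem posNorm_mono {f g : P → ℝ≥0∞} (hf : AEMeasurable f μ) (h : ∀ᵐ x ∂μ, f x ≤ g x) :
    X.posNorm f ≤ X.posNorm g := by
  by_cases hg : X.posNorm g < ∞
  · refine X.qnorm_mono _ _ (isL0_coe_iff.2 ⟨hf, ?_⟩) hg ?_
    · filter_upwards [h, (isL0_of_posNorm_lt_top hg).2] with x h1 h2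
      exact ne_top_of_le_ne_top h2 h1
    · simpa only [EReal.abs_coe_ennreal] using h
  · rw [not_lt, top_le_iff] at hg
    rw [hg]; exact le_top

theorem posNorm_abs_le (f : P → EReal) : X.posNorm (fun x => (f x).abs) ≤ X.qnorm f := by
  by_cases hf : X.qnorm f < ∞
  · have h0 := X.isL0_of_lt_top _ hf
    refine X.qnorm_mono _ _ (isL0_coe_iff.2
      ⟨EReal.measurable_abs.comp_aemeasurable h0.1, ?_⟩) hf ?_
    · filter_upwards [h0.2] with x hx
      exact EReal.abs_ne_top_iff.2 hx
    · simp only [EReal.abs_coe_ennreal]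
      exact Eventually.of_forall fun x => le_rfl
  · rw [not_lt, top_le_iff] at hf
    rw [hf]; exact le_top

theorem posNorm_eq_zero_iff {f : P → ℝ≥0∞} : X.posNorm f = 0 ↔ ∀ᵐ x ∂μ, f x = 0 := by
  rw [posNorm, X.qnorm_eq_zero_iff]
  simp

variable (X) in
theorem exists_posNorm_add_le : ∃ c : ℝ≥0, 1 ≤ c ∧ ∀ f g : P → ℝ≥0∞,
    X.posNorm (fun x => f x + g x) ≤ c * (X.posNorm f + X.posNorm g) := by
  obtain ⟨c, hc⟩ := X.qnorm_add_le
  refine ⟨max c 1, le_max_right _ _, fun f g => ?_⟩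
  have h1 : (1 : ℝ≥0∞) ≤ (max c 1 : ℝ≥0) := by exact_mod_cast le_max_right c 1
  by_cases hf : X.posNorm f < ∞
  · by_cases hg : X.posNorm g < ∞
    · calc X.posNorm (fun x => f x + g x) ≤ c * (X.posNorm f + X.posNorm g) := by
            simpa only [posNorm, EReal.coe_ennreal_add] using hc _ _ hf hg
        _ ≤ _ := by gcongr; exact le_max_left _ _
    · rw [not_lt, top_le_iff] at hg
      rw [hg, add_top, ENNReal.mul_top (by positivity)]; exact le_top
  · rw [not_lt, top_le_iff] at hf
    rw [hf, top_add, ENNReal.mul_top (by positivity)]; exact le_top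

theorem posNorm_mul_le (a : ℝ≥0) (f : P → ℝ≥0∞) :
    X.posNorm (fun x => a * f x) ≤ a * X.posNorm f := by
  by_cases hf : X.posNorm f < ∞
  · have := X.qnorm_smul a _ hf
    rw [abs_of_nonneg a.coe_nonneg, ENNReal.ofReal_coe_nnreal] at this
    refine le_of_eq (Eq.trans ?_ this)
    simp only [posNorm, EReal.coe_ennreal_mul]
    rfl
  · rw [not_lt, top_le_iff] at hf
    rcases eq_or_ne a 0 with rfl | ha
    · refine (posNorm_eq_zero_iff.2 ?_).trans_le zero_le
      simp
    · rw [hf, ENNReal.mul_top (by simpa using ha)]; exact le_top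

theorem posNorm_finset_sum_le {c : ℝ≥0} (hc1 : 1 ≤ c)
    (hc : ∀ f g : P → ℝ≥0∞, X.posNorm (fun x => f x + g x) ≤ c * (X.posNorm f + X.posNorm g))
    {f : ℕ → P → ℝ≥0∞} {δ : ℝ≥0∞}
    (hf : ∀ i, X.posNorm (f i) ≤ δ * ((2 * c : ℝ≥0∞)⁻¹) ^ i) (k : ℕ) : ∀ m : ℕ,
    X.posNorm (fun x => ∑ i ∈ Finset.range k, f (m + i) x)
      ≤ 2 * c * (δ * ((2 * c : ℝ≥0∞)⁻¹) ^ m) := by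
  induction k with
  | zero =>
    intro m
    refine (posNorm_eq_zero_iff.2 ?_).trans_le zero_le
    simp
  | succ k ih =>
    intro m
    have hc0 : (2 * c : ℝ≥0∞) ≠ 0 := by
      have : (c : ℝ≥0∞) ≠ 0 := by simpa using (zero_lt_one.trans_le hc1).ne'
      simp [this]
    have hct : (2 * c : ℝ≥0∞) ≠ ⊤ := ENNReal.mul_ne_top (by simp) (by simp)
    calc X.posNorm (fun x => ∑ i ∈ Finset.range (k + 1), f (m + i) x)
        = X.posNorm (fun x => f m x + ∑ i ∈ Finset.range k, f (m + 1 + i) x) := by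
          congr 1; ext x
          rw [Finset.sum_range_succ', add_comm]
          simp only [add_zero, add_assoc, add_comm 1]
      _ ≤ c * (X.posNorm (f m) + X.posNorm fun x => ∑ i ∈ Finset.range k, f (m + 1 + i) x) :=
          hc _ _
      _ ≤ c * (δ * ((2 * c : ℝ≥0∞)⁻¹) ^ m + 2 * c * (δ * ((2 * c : ℝ≥0∞)⁻¹) ^ (m + 1))) := by
          gcongr
          · exact hf m
          · exact ih (m + 1)
      _ = c * (δ * ((2 * c : ℝ≥0∞)⁻¹) ^ m
            + (2 * c * (2 * c : ℝ≥0∞)⁻¹) * (δ * ((2 * c : ℝ≥0∞)⁻¹) ^ m)) := by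
          rw [pow_succ]; ring
      _ = 2 * c * (δ * ((2 * c : ℝ≥0∞)⁻¹) ^ m) := by
          rw [ENNReal.mul_inv_cancel hc0 hct]; ring

/-- A countable form of the quasi-triangle inequality. Completeness is used to see that the sum is
finite almost everywhere, which is what the Fatou property asks of the limit. -/
theorem posNorm_tsum_le {c : ℝ≥0} (hc1 : 1 ≤ c)
    (hc : ∀ f g : P → ℝ≥0∞, X.posNorm (fun x => f x + g x) ≤ c * (X.posNorm f + X.posNorm g))
    {f : ℕ → P → ℝ≥0∞} {δ : ℝ≥0∞} (hδ : δ ≠ ⊤)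
    (hf : ∀ i, X.posNorm (f i) ≤ δ * ((2 * c : ℝ≥0∞)⁻¹) ^ i) :
    X.posNorm (fun x => ∑' i, f i x) ≤ 2 * c * δ := by
  set S : ℕ → P → ℝ≥0∞ := fun n x => ∑ i ∈ Finset.range n, f i x with hS
  set q : ℝ≥0∞ := (2 * c : ℝ≥0∞)⁻¹ with hq
  have hc1' : (1 : ℝ≥0∞) ≤ c := by exact_mod_cast hc1
  have hct : (2 * c : ℝ≥0∞) ≠ ⊤ := ENNReal.mul_ne_top (by simp) (by simp)
  have hq1 : q < 1 := by
    rw [hq, ENNReal.inv_lt_one]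
    calc (1 : ℝ≥0∞) < 2 := by norm_num
      _ = 2 * 1 := (mul_one _).symm
      _ ≤ 2 * c := by gcongr
  have hfin : ∀ i, X.posNorm (f i) < ∞ := fun i => (hf i).trans_lt
    (ENNReal.mul_lt_top hδ.lt_top (ENNReal.pow_lt_top (hq1.trans ENNReal.one_lt_top)))
  have hSle : ∀ n, X.posNorm (S n) ≤ 2 * c * δ := fun n => by
    simpa using posNorm_finset_sum_le hc1 hc hf n 0
  have hSfin : ∀ n, X.posNorm (S n) < ∞ := fun n =>
    (hSle n).trans_lt (ENNReal.mul_lt_top hct.lt_top hδ.lt_top)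
  have hfae : ∀ᵐ x ∂μ, ∀ n, S n x ≠ ⊤ :=
    ae_all_iff.2 fun n => (isL0_of_posNorm_lt_top (hSfin n)).2
  have hSmeas : ∀ n, AEMeasurable (S n) μ := fun n => (isL0_of_posNorm_lt_top (hSfin n)).1
  have hmono : ∀ x, Monotone fun n => S n x := fun x m n hmn =>
    Finset.sum_le_sum_of_subset (Finset.range_mono hmn)
  have hdiff : ∀ m n, m ≤ n → X.qnorm (fun x => (S n x : EReal) - S m x) ≤ 2 * c * (δ * q ^ m) ∧
      X.qnorm (fun x => (S m x : EReal) - S n x) ≤ 2 * c * (δ * q ^ m) := by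
    intro m n hmn
    obtain ⟨k, rfl⟩ := Nat.exists_eq_add_of_le hmn
    have key := posNorm_finset_sum_le hc1 hc hf k m
    have hkey : X.posNorm (fun x => ∑ i ∈ Finset.range k, f (m + i) x) < ∞ :=
      key.trans_lt (ENNReal.mul_lt_top hct.lt_top (ENNReal.mul_lt_top hδ.lt_top
        (ENNReal.pow_lt_top (hq1.trans ENNReal.one_lt_top))))
    have hae : ∀ᵐ x ∂μ, ∃ a b : ℝ≥0, S m x = a ∧ S (m + k) x = ((a + b : ℝ≥0) : ℝ≥0∞) ∧
        ∑ i ∈ Finset.range k, f (m + i) x = b := by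
      filter_upwards [hfae, (isL0_of_posNorm_lt_top hkey).2] with x hx hx2
      lift S m x to ℝ≥0 using hx m with a ha
      lift ∑ i ∈ Finset.range k, f (m + i) x to ℝ≥0 using hx2 with b hb
      refine ⟨a, b, rfl, ?_, rfl⟩
      simp only [hS, Finset.sum_range_add]
      rw [ENNReal.coe_add, ha, hb]
    have hm : ∀ n, AEMeasurable (fun x => (S n x).toReal) μ := fun n =>
      (hSmeas n).ennreal_toReal
    refine ⟨(X.qnorm_mono _ _ ⟨?_, ?_⟩ hkey ?_).trans key,
      (X.qnorm_mono _ _ ⟨?_, ?_⟩ hkey ?_).trans key⟩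
    · refine ((hm (m + k)).sub (hm m)).coe_real_ereal.congr ?_
      filter_upwards [hae] with x ⟨a, b, h1, h2, _⟩
      rw [h1, h2, EReal.coe_nnreal_eq_coe_real, EReal.coe_nnreal_eq_coe_real]
      rw [← EReal.coe_sub]
      simp only [Pi.sub_apply, h1, h2, ENNReal.coe_toReal]
    · filter_upwards [hae] with x ⟨a, b, h1, h2, _⟩
      rw [h1, h2, EReal.coe_nnreal_eq_coe_real, EReal.coe_nnreal_eq_coe_real]
      exact ⟨by exact_mod_cast EReal.coe_ne_top _, by exact_mod_cast EReal.coe_ne_bot _⟩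
    · filter_upwards [hae] with x ⟨a, b, h1, h2, h3⟩
      rw [h1, h2, h3, EReal.abs_coe_ennreal, EReal.coe_nnreal_eq_coe_real,
        EReal.coe_nnreal_eq_coe_real, ← EReal.coe_sub, EReal.abs_def]
      simp
    · refine ((hm m).sub (hm (m + k))).coe_real_ereal.congr ?_
      filter_upwards [hae] with x ⟨a, b, h1, h2, _⟩
      rw [h1, h2, EReal.coe_nnreal_eq_coe_real, EReal.coe_nnreal_eq_coe_real]
      rw [← EReal.coe_sub]
      simp only [Pi.sub_apply, h1, h2, ENNReal.coe_toReal]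
    · filter_upwards [hae] with x ⟨a, b, h1, h2, _⟩
      rw [h1, h2, EReal.coe_nnreal_eq_coe_real, EReal.coe_nnreal_eq_coe_real]
      exact ⟨by exact_mod_cast EReal.coe_ne_top _, by exact_mod_cast EReal.coe_ne_bot _⟩
    · filter_upwards [hae] with x ⟨a, b, h1, h2, h3⟩
      rw [h1, h2, h3, EReal.abs_coe_ennreal, EReal.coe_nnreal_eq_coe_real,
        EReal.coe_nnreal_eq_coe_real, ← EReal.coe_sub, EReal.abs_def]
      simp
  have hlim : Tendsto (fun m => 2 * c * (δ * q ^ m)) atTop (𝓝 0) := by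
    have h1 := ENNReal.tendsto_pow_atTop_nhds_zero_of_lt_one hq1
    have h2 := ENNReal.Tendsto.const_mul h1 (Or.inr hδ)
    have h3 := ENNReal.Tendsto.const_mul h2 (Or.inr hct)
    simpa using h3
  obtain ⟨h, hh, hhlim⟩ := X.complete (fun n x => (S n x : EReal)) hSfin (by
    intro ε hε
    obtain ⟨N, hN⟩ := ((hlim.eventually (gt_mem_nhds hε))).exists
    have hmonoN : ∀ m ≥ N, 2 * c * (δ * q ^ m) < ε := fun m hm =>
      lt_of_le_of_lt (by gcongr _ * (_ * ?_); exact pow_le_pow_right_of_le_one' hq1.le hm) hN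
    refine ⟨N, fun m hm n hn => ?_⟩
    rcases le_total m n with hmn | hmn
    · exact (hdiff m n hmn).2.trans_lt (hmonoN m hm)
    · exact (hdiff n m hmn).1.trans_lt (hmonoN n hn))
  have hhL := X.isL0_of_lt_top _ hh
  have hle : ∀ n, ∀ᵐ x ∂μ, S n x ≤ (h x).abs := by
    intro n
    have hzero : X.posNorm (fun x => S n x - (h x).abs) = 0 := by
      refine le_antisymm (ge_of_tendsto hhlim ?_) zero_le
      filter_upwards [eventually_ge_atTop n] with m hm
      refine (posNorm_mono ((hSmeas n).sub (EReal.measurable_abs.comp_aemeasurable hhL.1))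
        ?_).trans (posNorm_abs_le _)
      filter_upwards [hfae, hhL.2] with x hx hx2
      have hnm := hmono x hm
      simp only at hnm
      refine tsub_le_iff_right.2 (hnm.trans ?_)
      change S m x ≤ ((S m x : EReal) - h x).abs + (h x).abs
      lift h x to ℝ using hx2 with b
      lift S m x to ℝ≥0 using hx m with a
      rw [EReal.coe_nnreal_eq_coe_real, ← EReal.coe_sub, EReal.abs_def, EReal.abs_def,
        ← ENNReal.ofReal_add (abs_nonneg _) (abs_nonneg _), ← ENNReal.ofReal_coe_nnreal]
      refine ENNReal.ofReal_le_ofReal ?_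
      have := abs_add_le ((a : ℝ) - b) b
      simp only [sub_add_cancel] at this
      exact (le_abs_self _).trans this
    filter_upwards [posNorm_eq_zero_iff.1 hzero] with x hx
    exact tsub_eq_zero_iff_le.1 hx
  have hsumle : ∀ᵐ x ∂μ, ∑' i, f i x ≤ (h x).abs := by
    filter_upwards [ae_all_iff.2 hle] with x hx
    rw [ENNReal.tsum_eq_iSup_nat]
    exact iSup_le hx
  have hsumL : IsL0 μ (fun x => ((∑' i, f i x : ℝ≥0∞) : EReal)) := by
    refine isL0_coe_iff.2 ⟨AEMeasurable.tsum fun i =>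
      (isL0_of_posNorm_lt_top (hfin i)).1, ?_⟩
    filter_upwards [hsumle, hhL.2] with x hx hx2
    exact ne_top_of_le_ne_top (EReal.abs_ne_top_iff.2 hx2) hx
  have hF := X.qnorm_tendsto (fun n x => (S n x : EReal)) _
    (fun n => X.isL0_of_lt_top _ (hSfin n)) hsumL (Eventually.of_forall fun x =>
      ⟨fun k => EReal.coe_ennreal_nonneg _,
        fun m n hmn => EReal.coe_ennreal_le_coe_ennreal_iff.2 (hmono x hmn),
        (continuous_coe_ennreal_ereal.tendsto _).comp
          (ENNReal.tendsto_nat_tsum fun i => f i x)⟩)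
  exact le_of_tendsto' hF hSle

end QuasiBanachFunctionSpace

/-! ### Nonnegative test functions for the capacity -/

/-- `G` is an `s`-gradient of the nonnegative function `T`, in subtraction-free form. -/
def HasPosGradient {P : Type*} [MetricSpace P] [MeasurableSpace P] (μ : Measure P) (s : ℝ)
    (T G : P → ℝ≥0∞) : Prop :=
  AEMeasurable G μ ∧ ∃ N : Set P, μ N = 0 ∧ ∀ x ∉ N, ∀ y ∉ N,
    T x ≤ T y + ENNReal.ofReal (dist x y ^ s) * (G x + G y)

theorem EReal.abs_le_abs_add_abs_sub {a b : EReal} (ha : a ≠ ⊤ ∧ a ≠ ⊥) (hb : b ≠ ⊤ ∧ b ≠ ⊥) :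
    a.abs ≤ b.abs + (a - b).abs := by
  lift a to ℝ using ha
  lift b to ℝ using hb
  rw [← EReal.coe_sub, EReal.abs_def, EReal.abs_def, EReal.abs_def,
    ← ENNReal.ofReal_add (abs_nonneg _) (abs_nonneg _)]
  refine ENNReal.ofReal_le_ofReal ?_
  have := abs_add_le b (a - b)
  simpa using this

theorem EReal.abs_coe_sub_coe_le {a b k : ℝ≥0∞} (ha : a ≠ ⊤) (hb : b ≠ ⊤) (h1 : a ≤ b + k)
    (h2 : b ≤ a + k) : ((a : EReal) - b).abs ≤ k := by
  lift a to ℝ≥0 using ha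
  lift b to ℝ≥0 using hb
  induction k with
  | top => exact le_top
  | coe k =>
    have h1' : (a : ℝ) ≤ b + k := by exact_mod_cast h1
    have h2' : (b : ℝ) ≤ a + k := by exact_mod_cast h2
    rw [EReal.coe_nnreal_eq_coe_real, EReal.coe_nnreal_eq_coe_real, ← EReal.coe_sub,
      EReal.abs_def, ← ENNReal.ofReal_coe_nnreal]
    exact ENNReal.ofReal_le_ofReal (abs_le.2 ⟨by linarith, by linarith⟩)

section

variable {P : Type*} [MetricSpace P] [MeasurableSpace P] {μ : Measure P} {s : ℝ}

theorem HasPosGradient.add {T₁ T₂ G₁ G₂ : P → ℝ≥0∞} (h₁ : HasPosGradient μ s T₁ G₁)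
    (h₂ : HasPosGradient μ s T₂ G₂) :
    HasPosGradient μ s (fun x => T₁ x + T₂ x) (fun x => G₁ x + G₂ x) := by
  obtain ⟨m₁, N₁, n₁, k₁⟩ := h₁
  obtain ⟨m₂, N₂, n₂, k₂⟩ := h₂
  refine ⟨m₁.add m₂, N₁ ∪ N₂, measure_union_null n₁ n₂, fun x hx y hy => ?_⟩
  rw [mem_union, not_or] at hx hy
  calc T₁ x + T₂ x ≤ _ := add_le_add (k₁ x hx.1 y hy.1) (k₂ x hx.2 y hy.2)
    _ = _ := by ring

theorem HasPosGradient.const_mul {T G : P → ℝ≥0∞} (h : HasPosGradient μ s T G) (a : ℝ≥0∞) :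
    HasPosGradient μ s (fun x => a * T x) (fun x => a * G x) := by
  obtain ⟨m, N, n, k⟩ := h
  refine ⟨m.const_mul a, N, n, fun x hx y hy => ?_⟩
  calc a * T x ≤ _ := mul_le_mul_right (k x hx y hy) a
    _ = _ := by ring

theorem HasPosGradient.tsum {T G : ℕ → P → ℝ≥0∞} (h : ∀ i, HasPosGradient μ s (T i) (G i)) :
    HasPosGradient μ s (fun x => ∑' i, T i x) (fun x => ∑' i, G i x) := by
  choose m N n k using h
  refine ⟨AEMeasurable.tsum m, ⋃ i, N i, measure_iUnion_null n, fun x hx y hy => ?_⟩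
  simp only [mem_iUnion, not_exists] at hx hy
  rw [← ENNReal.tsum_add, ← ENNReal.tsum_mul_left, ← ENNReal.tsum_add]
  exact ENNReal.tsum_le_tsum fun i => k i x (hx i) y (hy i)

/-- Off a null set, the absolute value of an almost everywhere finite function inherits the
`s`-gradients of the function. -/
theorem IsSGradient.hasPosGradient_abs {u : P → EReal} {g : P → ℝ≥0∞} (h : IsSGradient μ s u g)
    (hu : ∀ᵐ x ∂μ, u x ≠ ⊤ ∧ u x ≠ ⊥) : HasPosGradient μ s (fun x => (u x).abs) g := by
  obtain ⟨m, N, n, k⟩ := h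
  refine ⟨m, N ∪ {x | ¬ (u x ≠ ⊤ ∧ u x ≠ ⊥)}, measure_union_null n hu, fun x hx y hy => ?_⟩
  simp only [mem_union, not_or, mem_ofPred_eq, not_not] at hx hy
  refine (EReal.abs_le_abs_add_abs_sub hx.2 hy.2).trans ?_
  gcongr
  exact k x hx.1 y hy.1

theorem exists_posNorm_gradient_lt {X : QuasiBanachFunctionSpace μ} {u : P → EReal} {ε : ℝ≥0∞}
    (hu : ∀ᵐ x ∂μ, u x ≠ ⊤ ∧ u x ≠ ⊥) (h : homHajlaszNorm X s u < ε) :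
    ∃ g, HasPosGradient μ s (fun x => (u x).abs) g ∧ X.posNorm g < ε := by
  simp only [homHajlaszNorm, iInf_lt_iff] at h
  obtain ⟨g, hg, hlt⟩ := h
  exact ⟨g, hg.hasPosGradient_abs hu, hlt⟩

theorem hajlaszCapacity_le {X : QuasiBanachFunctionSpace μ} {E U : Set P} {T G : P → ℝ≥0∞}
    (hG : HasPosGradient μ s T G) (hU : IsOpen U) (hEU : E ⊆ U)
    (h1 : ∀ x ∈ U, 1 ≤ T x) : hajlaszCapacity X s E ≤ X.posNorm T + X.posNorm G := by
  by_cases hfin : X.posNorm T + X.posNorm G < ∞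
  · rw [ENNReal.add_lt_top] at hfin
    have hTL := X.isL0_of_lt_top _ hfin.1
    obtain ⟨m, N, n, k⟩ := hG
    have hTf := (QuasiBanachFunctionSpace.isL0_of_posNorm_lt_top hfin.1).2
    have hgrad : IsSGradient μ s (fun x => (T x : EReal)) G := by
      refine ⟨m, N ∪ {x | ¬ T x ≠ ⊤}, measure_union_null n hTf, fun x hx y hy => ?_⟩
      simp only [mem_union, not_or, mem_ofPred_eq, not_not] at hx hy
      refine EReal.abs_coe_sub_coe_le hx.2 hy.2 (k x hx.1 y hy.1) ?_
      rw [dist_comm x y, add_comm (G x)]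
      exact k y hy.1 x hx.1
    have hhom : homHajlaszNorm X s (fun x => (T x : EReal)) ≤ X.posNorm G :=
      iInf₂_le G hgrad
    refine (iInf₂_le (fun x => (T x : EReal)) ⟨⟨⟨hTL, hhom.trans_lt hfin.2⟩, hfin.1⟩,
      U, hU, hEU, fun x hx => ?_⟩).trans (add_le_add le_rfl hhom)
    change (1 : EReal) ≤ (T x : EReal)
    exact_mod_cast h1 x hx
  · rw [not_lt, top_le_iff] at hfin
    rw [hfin]; exact le_top

theorem exists_test_of_hajlaszCapacity_lt {X : QuasiBanachFunctionSpace μ} {E : Set P} {ε : ℝ≥0∞}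
    (h : hajlaszCapacity X s E < ε) :
    ∃ (U : Set P) (T G : P → ℝ≥0∞), IsOpen U ∧ E ⊆ U ∧ (∀ x ∈ U, 1 ≤ T x) ∧
      HasPosGradient μ s T G ∧ X.posNorm T + X.posNorm G < ε := by
  simp only [hajlaszCapacity, iInf_lt_iff] at h
  obtain ⟨w, ⟨hw, U, hU, hEU, h1⟩, hlt⟩ := h
  have hlt' : homHajlaszNorm X s w < ε - X.qnorm w := lt_tsub_iff_left.2 hlt
  obtain ⟨g, hg, hgn⟩ := exists_posNorm_gradient_lt hw.1.1.2 hlt'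
  refine ⟨U, fun x => (w x).abs, g, hU, hEU, fun x hx => ?_, hg, ?_⟩
  · have := (h1 x hx).trans (EReal.le_coe_abs _)
    exact_mod_cast this
  · exact (add_le_add (QuasiBanachFunctionSpace.posNorm_abs_le w) le_rfl).trans_lt
      (lt_tsub_iff_left.1 hgn)

theorem hajlaszCapacity_mono {X : QuasiBanachFunctionSpace μ} {A B : Set P} (h : A ⊆ B) :
    hajlaszCapacity X s A ≤ hajlaszCapacity X s B :=
  le_iInf₂ fun u ⟨hu, U, hU, hBU, h1⟩ => iInf₂_le u ⟨hu, U, hU, h.trans hBU, h1⟩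

theorem hajlaszCapacity_iUnion_nat_eq_zero {X : QuasiBanachFunctionSpace μ} {E : ℕ → Set P}
    (h : ∀ i, hajlaszCapacity X s (E i) = 0) : hajlaszCapacity X s (⋃ i, E i) = 0 := by
  obtain ⟨c, hc1, hc⟩ := X.exists_posNorm_add_le
  have hct : (2 * c : ℝ≥0∞) ≠ ⊤ := ENNReal.mul_ne_top (by simp) (by simp)
  have key : ∀ δ : ℝ≥0, 0 < δ → hajlaszCapacity X s (⋃ i, E i) ≤ 2 * c * δ + 2 * c * δ := by
    intro δ hδ
    have hpos : ∀ i : ℕ, 0 < (δ : ℝ≥0∞) * ((2 * c : ℝ≥0∞)⁻¹) ^ i := fun i =>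
      ENNReal.mul_pos (by simpa using hδ.ne') (pow_ne_zero _ (ENNReal.inv_ne_zero.2 hct))
    have hex := fun i => exists_test_of_hajlaszCapacity_lt ((h i).trans_lt (hpos i))
    choose U T G hU hEU h1 hG hn using hex
    have hT : ∀ i, X.posNorm (T i) ≤ δ * ((2 * c : ℝ≥0∞)⁻¹) ^ i := fun i =>
      le_self_add.trans (hn i).le
    refine (hajlaszCapacity_le (HasPosGradient.tsum hG) (isOpen_iUnion hU) (iUnion_mono hEU)
      fun x hx => ?_).trans
      (add_le_add (QuasiBanachFunctionSpace.posNorm_tsum_le hc1 hc ENNReal.coe_ne_top hT)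
      (QuasiBanachFunctionSpace.posNorm_tsum_le hc1 hc ENNReal.coe_ne_top fun i =>
        le_add_self.trans (hn i).le))
    obtain ⟨i, hi⟩ := mem_iUnion.1 hx
    exact (h1 i x hi).trans (ENNReal.le_tsum i)
  have hlim : Tendsto (fun δ : ℝ≥0 => 2 * c * (δ : ℝ≥0∞) + 2 * c * δ) (𝓝[>] 0) (𝓝 0) := by
    have h0 : Tendsto (fun δ : ℝ≥0 => (δ : ℝ≥0∞)) (𝓝[>] 0) (𝓝 0) :=
      (ENNReal.tendsto_coe.2 tendsto_id).mono_left nhdsWithin_le_nhds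
    have h2 := ENNReal.Tendsto.const_mul h0 (Or.inr hct)
    simpa using h2.add h2
  refine le_antisymm (ge_of_tendsto hlim ?_) zero_le
  filter_upwards [self_mem_nhdsWithin] with δ hδ using key δ hδ

theorem hajlaszCapacity_empty {X : QuasiBanachFunctionSpace μ} :
    hajlaszCapacity X s (∅ : Set P) = 0 := by
  have h0 : X.posNorm (fun _ => 0) = 0 :=
    QuasiBanachFunctionSpace.posNorm_eq_zero_iff.2 (by simp)
  have := hajlaszCapacity_le (X := X) (s := s) (E := ∅) (U := ∅) (T := fun _ => 0)
    (G := fun _ => 0) ⟨aemeasurable_const, ∅, by simp, by simp⟩ isOpen_empty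
    (empty_subset _) (by simp)
  simpa [h0] using this

theorem hajlaszCapacity_iUnion_eq_zero {X : QuasiBanachFunctionSpace μ} {ι : Type*} [Countable ι]
    {E : ι → Set P} (h : ∀ i, hajlaszCapacity X s (E i) = 0) :
    hajlaszCapacity X s (⋃ i, E i) = 0 := by
  rcases isEmpty_or_nonempty ι with hι | hι
  · rw [iUnion_of_empty, hajlaszCapacity_empty]
  · obtain ⟨e, he⟩ := exists_surjective_nat ι
    rw [← he.iUnion_comp]
    exact hajlaszCapacity_iUnion_nat_eq_zero fun n => h (e n)

end

/-! ### Quantiles over balls -/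

/-- The upper `γ`-quantile over `A` of a function with values in `[0, 1]`: the largest `t` such
that the function is at least `t` on a portion `γ` of `A`. Unlike the `γ`-median it is real, and
it equals `1` as soon as the function is `1` on a portion `γ` of `A`. -/
noncomputable def upperQuantile {P : Type*} [MeasurableSpace P] (μ : Measure P) (γ : ℝ≥0∞)
    (f : P → ℝ) (A : Set P) : ℝ :=
  sSup {t : ℝ | t ∈ Icc (0 : ℝ) 1 ∧ γ * μ A ≤ μ {y | y ∈ A ∧ t ≤ f y}}

section quantile

variable {P : Type*} [MeasurableSpace P] {μ : Measure P} {γ : ℝ≥0∞} {f : P → ℝ} {A : Set P}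

theorem bddAbove_upperQuantile_set (μ : Measure P) (γ : ℝ≥0∞) (f : P → ℝ) (A : Set P) :
    BddAbove {t : ℝ | t ∈ Icc (0 : ℝ) 1 ∧ γ * μ A ≤ μ {y | y ∈ A ∧ t ≤ f y}} :=
  ⟨1, fun _ ht => ht.1.2⟩

theorem upperQuantile_nonneg : 0 ≤ upperQuantile μ γ f A :=
  Real.sSup_nonneg fun _ ht => ht.1.1

theorem upperQuantile_le_one : upperQuantile μ γ f A ≤ 1 :=
  Real.sSup_le (fun _ ht => ht.1.2) zero_le_one

theorem one_le_upperQuantile (h : γ * μ A ≤ μ {y | y ∈ A ∧ 1 ≤ f y}) :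
    1 ≤ upperQuantile μ γ f A :=
  le_csSup (bddAbove_upperQuantile_set μ γ f A) ⟨⟨zero_le_one, le_rfl⟩, h⟩

/-- If `f` is within `K` of `t` on `A`, up to a portion less than `γ ≤ 1/2`, then so is its upper
`γ`-quantile. -/
theorem abs_upperQuantile_sub_le (hγ : γ + γ ≤ 1) (hA : μ A ≠ ∞) (hf0 : ∀ x, 0 ≤ f x)
    (hf1 : ∀ x, f x ≤ 1)
    {t K : ℝ} (h : μ {y | y ∈ A ∧ ¬ |f y - t| ≤ K} < γ * μ A) :
    |upperQuantile μ γ f A - t| ≤ K := by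
  have hγ1 : γ ≠ ∞ := ne_top_of_le_ne_top ENNReal.one_ne_top (le_self_add.trans hγ)
  have hfin : γ * μ A ≠ ∞ := ENNReal.mul_ne_top hγ1 hA
  rw [abs_le]
  constructor
  · rcases le_total (t - K) 0 with h0 | h0
    · linarith [upperQuantile_nonneg (μ := μ) (γ := γ) (f := f) (A := A)]
    · have hge : γ * μ A ≤ μ {y | y ∈ A ∧ t - K ≤ f y} := by
        by_contra hlt
        rw [not_le] at hlt
        have hsub : A ⊆ {y | y ∈ A ∧ ¬ |f y - t| ≤ K} ∪ {y | y ∈ A ∧ t - K ≤ f y} := by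
          intro y hy
          by_cases hy1 : |f y - t| ≤ K
          · exact Or.inr ⟨hy, by linarith [(abs_le.1 hy1).1]⟩
          · exact Or.inl ⟨hy, hy1⟩
        have := calc μ A ≤ _ := (measure_mono hsub).trans (measure_union_le _ _)
          _ < γ * μ A + γ * μ A := ENNReal.add_lt_add h hlt
          _ = (γ + γ) * μ A := by ring
          _ ≤ 1 * μ A := by gcongr
          _ = μ A := one_mul _
        exact lt_irrefl _ this
      have hne : {y | y ∈ A ∧ t - K ≤ f y}.Nonempty := by
        refine nonempty_of_measure_ne_zero (μ := μ) ?_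
        exact (pos_of_gt (h.trans_le hge)).ne'
      obtain ⟨y, -, hy⟩ := hne
      have := le_csSup (bddAbove_upperQuantile_set μ γ f A)
        (show t - K ∈ _ from ⟨⟨h0, hy.trans (hf1 y)⟩, hge⟩)
      unfold upperQuantile
      linarith
  · rw [sub_le_iff_le_add]
    have hK : 0 ≤ K + t := by
      by_contra hneg
      rw [not_le] at hneg
      have hsub : A ⊆ {y | y ∈ A ∧ ¬ |f y - t| ≤ K} := fun y hy =>
        ⟨hy, fun hy2 => by linarith [(abs_le.1 hy2).2, hf0 y]⟩
      exact lt_irrefl (μ A) ((measure_mono hsub).trans_lt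
        (h.trans_le ((mul_le_mul_left (le_self_add.trans hγ) _).trans_eq (one_mul _))))
    refine Real.sSup_le (fun r hr => ?_) hK
    by_contra hlt
    rw [not_le] at hlt
    refine lt_irrefl _ ((hr.2.trans (measure_mono ?_)).trans_lt h)
    rintro y ⟨hy, hy1⟩
    refine ⟨hy, fun hy2 => ?_⟩
    linarith [(abs_le.1 hy2).2]

end quantile

theorem IsDoublingMeasure.exists_one_le {P : Type*} [MetricSpace P] [MeasurableSpace P]
    {μ : Measure P} (hμ : IsDoublingMeasure μ) : ∃ c : ℝ≥0, 1 ≤ c ∧ ∀ (x : P) (r : ℝ), 0 < r →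
      μ (Metric.ball x (2 * r)) ≤ c * μ (Metric.ball x r) := by
  obtain ⟨c, hc⟩ := hμ.doubling
  refine ⟨max c 1, le_max_right _ _, fun x r hr => (hc x r hr).trans ?_⟩
  gcongr
  exact le_max_left _ _

/-! ### The quantile maximal function -/

section maximal

variable {P : Type*} [MetricSpace P] [MeasurableSpace P]

/-- The largest drop of the upper quantiles at scale `ρ` between `z` and points at distance less
than `2 * ρ` from it. -/
noncomputable def quantileDrop (μ : Measure P) (γ : ℝ≥0∞) (f : P → ℝ) (ρ : ℝ) (z : P) : ℝ :=
  sSup ((fun z' => upperQuantile μ γ f (Metric.ball z ρ) - upperQuantile μ γ f (Metric.ball z' ρ))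
    '' Metric.ball z (2 * ρ))

/-- A cone centred at `z`, of height the upper quantile over the ball `B(z, ρ)`. Its slope is such
that, at distance between `ρ` and `2 * ρ` from `z`, it would lie below the quantiles over the balls
of radius `ρ` centred there; so it may be cut off at distance `ρ`. -/
noncomputable def quantileCone (μ : Measure P) (γ : ℝ≥0∞) (f : P → ℝ) (ρ : ℝ) (z x : P) : ℝ :=
  open Classical in
  if dist x z < ρ then
    max 0 (upperQuantile μ γ f (Metric.ball z ρ) - quantileDrop μ γ f ρ z * (dist x z / ρ))
  else 0

/-- The quantile maximal function: the supremum of the cones of radius less than `1 / 4`.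
It is a smoothed supremum of the upper quantiles over the balls centred at `x`. -/
noncomputable def quantileMaximal (μ : Measure P) (γ : ℝ≥0∞) (f : P → ℝ) (x : P) : ℝ :=
  ⨆ i : Ioo (0 : ℝ) (1 / 4) × P, quantileCone μ γ f i.1 i.2 x

variable {μ : Measure P} {γ : ℝ≥0∞} {f : P → ℝ}

theorem sub_le_quantileDrop {ρ : ℝ} {z z' : P} (h : dist z' z < 2 * ρ) :
    upperQuantile μ γ f (Metric.ball z ρ) - upperQuantile μ γ f (Metric.ball z' ρ)
      ≤ quantileDrop μ γ f ρ z := by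
  refine le_csSup ⟨1, ?_⟩ ⟨z', h, rfl⟩
  rintro _ ⟨y, -, rfl⟩
  have h1 := upperQuantile_le_one (μ := μ) (γ := γ) (f := f) (A := Metric.ball z ρ)
  have h2 := upperQuantile_nonneg (μ := μ) (γ := γ) (f := f) (A := Metric.ball y ρ)
  simp only
  linarith

theorem quantileDrop_nonneg {ρ : ℝ} (hρ : 0 < ρ) (z : P) : 0 ≤ quantileDrop μ γ f ρ z := by
  have := sub_le_quantileDrop (μ := μ) (γ := γ) (f := f) (ρ := ρ) (z := z) (z' := z)
    (by simpa using hρ)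
  linarith

theorem quantileCone_nonneg (ρ : ℝ) (z x : P) : 0 ≤ quantileCone μ γ f ρ z x := by
  unfold quantileCone
  split_ifs
  · exact le_max_left _ _
  · exact le_rfl

theorem quantileCone_le {ρ : ℝ} (hρ : 0 < ρ) (z x : P) :
    quantileCone μ γ f ρ z x ≤ upperQuantile μ γ f (Metric.ball z ρ) := by
  unfold quantileCone
  split_ifs
  · refine max_le upperQuantile_nonneg (sub_le_self _ ?_)
    exact mul_nonneg (quantileDrop_nonneg hρ z) (by positivity)
  · exact upperQuantile_nonneg

theorem bddAbove_quantileCone (x : P) : BddAbove (range fun i : Ioo (0 : ℝ) (1 / 4) × P =>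
    quantileCone μ γ f i.1 i.2 x) := by
  refine ⟨1, ?_⟩
  rintro _ ⟨i, rfl⟩
  exact (quantileCone_le i.1.2.1 _ _).trans upperQuantile_le_one

theorem quantileCone_le_quantileMaximal {ρ : ℝ} (hρ : 0 < ρ) (hρ1 : ρ < 1 / 4) (z x : P) :
    quantileCone μ γ f ρ z x ≤ quantileMaximal μ γ f x :=
  le_ciSup (bddAbove_quantileCone x) (⟨⟨ρ, hρ, hρ1⟩, z⟩ : Ioo (0 : ℝ) (1 / 4) × P)

theorem upperQuantile_le_quantileMaximal {ρ : ℝ} (hρ : 0 < ρ) (hρ1 : ρ < 1 / 4) (x : P) :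
    upperQuantile μ γ f (Metric.ball x ρ) ≤ quantileMaximal μ γ f x := by
  refine le_trans ?_ (quantileCone_le_quantileMaximal hρ hρ1 x x)
  simp [quantileCone, hρ]

theorem quantileMaximal_nonneg (x : P) : 0 ≤ quantileMaximal μ γ f x :=
  upperQuantile_nonneg.trans
    (upperQuantile_le_quantileMaximal (ρ := 1 / 8) (by norm_num) (by norm_num) x)

theorem lowerSemicontinuous_quantileCone (ρ : ℝ) (z : P) :
    LowerSemicontinuous (quantileCone μ γ f ρ z) := by
  intro x y hy
  by_cases hx : dist x z < ρ
  · have hc : Continuous fun x' => max 0 (upperQuantile μ γ f (Metric.ball z ρ)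
        - quantileDrop μ γ f ρ z * (dist x' z / ρ)) := by fun_prop
    rw [quantileCone, if_pos hx] at hy
    filter_upwards [hc.continuousAt.eventually (lt_mem_nhds hy),
      Metric.isOpen_ball.mem_nhds (show x ∈ Metric.ball z ρ from hx)] with x' h1 h2
    rw [quantileCone, if_pos (Metric.mem_ball.1 h2)]
    exact h1
  · rw [quantileCone, if_neg hx] at hy
    exact Eventually.of_forall fun x' => hy.trans_le (quantileCone_nonneg _ _ _)

theorem measurable_quantileMaximal [OpensMeasurableSpace P] :
    Measurable (quantileMaximal μ γ f) :=
  (lowerSemicontinuous_ciSup bddAbove_quantileCone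
    fun _ => lowerSemicontinuous_quantileCone _ _).measurable

/-- The quantile maximal function is `1` in a whole ball in which `f` is `1` on a fixed portion. -/
theorem one_le_quantileMaximal {c : ℝ≥0} (hc : ∀ (x : P) (r : ℝ), 0 < r →
      μ (Metric.ball x (2 * r)) ≤ c * μ (Metric.ball x r))
    {θ : ℝ≥0∞} (hγ : γ * (c * c) ≤ θ) {U : Set P} (hfU : ∀ x ∈ U, 1 ≤ f x)
    {x : P} {r : ℝ} (hr : 0 < r) (hr1 : r < 1 / 8)
    (h : θ * μ (Metric.ball x r) ≤ μ (Metric.ball x r ∩ U)) {y : P} (hy : dist y x < r) :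
    1 ≤ quantileMaximal μ γ f y := by
  refine le_trans (one_le_upperQuantile ?_)
    (upperQuantile_le_quantileMaximal (ρ := 2 * r) (by linarith) (by linarith) y)
  calc γ * μ (Metric.ball y (2 * r)) ≤ γ * μ (Metric.ball x (2 * (2 * r))) := by
        gcongr
        exact Metric.ball_subset_ball' (by linarith)
    _ ≤ γ * (c * (c * μ (Metric.ball x r))) := by
        gcongr
        exact (hc x _ (by linarith)).trans (by gcongr; exact hc x r hr)
    _ = γ * (c * c) * μ (Metric.ball x r) := by ring
    _ ≤ θ * μ (Metric.ball x r) := by gcongr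
    _ ≤ μ (Metric.ball x r ∩ U) := h
    _ ≤ μ {w | w ∈ Metric.ball y (2 * r) ∧ 1 ≤ f w} := by
        refine measure_mono ?_
        rintro w ⟨hw, hwU⟩
        exact ⟨Metric.ball_subset_ball' (by rw [dist_comm]; linarith) hw, hfU w hwU⟩

end maximal

/-! ### Gradient estimates for the quantile maximal function -/

section gradient

variable {P : Type*} [MetricSpace P] [MeasurableSpace P] {μ : Measure P} {γ δ : ℝ≥0∞} {c : ℝ≥0}
  {f g : P → ℝ} {s : ℝ} {N : Set P}

/-- In every ball of radius less than `1` centred at `x`, the function `g` exceeds `l` on a portion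
less than `δ` only. This is how a bound for the median maximal function of `g` at `x` is used. -/
def PortionBound (μ : Measure P) (δ : ℝ≥0∞) (g : P → ℝ) (x : P) (l : ℝ) : Prop :=
  0 ≤ l ∧ ∀ r : ℝ, 0 < r → r < 1 →
    μ {y | y ∈ Metric.ball x r ∧ l < g y} < δ * μ (Metric.ball x r)

/-- The bound at `x` passes, by doubling, to the balls of radius `ρ` with centre near `x`. -/
theorem measure_exceptional_lt
    (hc : ∀ (x : P) (r : ℝ), 0 < r → μ (Metric.ball x (2 * r)) ≤ c * μ (Metric.ball x r))
    (hδ : δ * c ^ 3 ≤ γ) (hN : μ N = 0) {x z : P} {l ρ : ℝ} (hl : PortionBound μ δ g x l)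
    (hρ : 0 < ρ) (hρ1 : ρ < 1 / 4) (hz : dist z x < 3 * ρ) :
    μ {y | y ∈ Metric.ball z ρ ∧ (y ∈ N ∨ l < g y)} < γ * μ (Metric.ball z ρ) := by
  calc μ {y | y ∈ Metric.ball z ρ ∧ (y ∈ N ∨ l < g y)}
      ≤ μ (N ∪ {y | y ∈ Metric.ball x (4 * ρ) ∧ l < g y}) := by
        refine measure_mono ?_
        rintro y ⟨hy, hyN | hyl⟩
        · exact Or.inl hyN
        · exact Or.inr ⟨Metric.ball_subset_ball' (by linarith) hy, hyl⟩
    _ ≤ μ N + μ {y | y ∈ Metric.ball x (4 * ρ) ∧ l < g y} := measure_union_le _ _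
    _ = μ {y | y ∈ Metric.ball x (4 * ρ) ∧ l < g y} := by rw [hN, zero_add]
    _ < δ * μ (Metric.ball x (4 * ρ)) := hl.2 _ (by linarith) (by linarith)
    _ ≤ δ * μ (Metric.ball z (2 * (2 * (2 * ρ)))) := by
        gcongr
        exact Metric.ball_subset_ball' (by rw [dist_comm]; linarith)
    _ ≤ δ * (c * (c * (c * μ (Metric.ball z ρ)))) := by
        gcongr
        refine (hc z _ (by linarith)).trans ?_
        gcongr
        refine (hc z _ (by linarith)).trans ?_
        gcongr
        exact hc z _ hρ
    _ = δ * c ^ 3 * μ (Metric.ball z ρ) := by ring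
    _ ≤ γ * μ (Metric.ball z ρ) := by gcongr

/-- The quantile over a ball `B(z, ρ)` near `x` is close to the value of `f` at any point `p`: most
points `y` of the ball satisfy `g y ≤ l`, and there `f y` is close to `f p`. -/
theorem abs_upperQuantile_sub_point_le (hμ : IsDoublingMeasure μ)
    (hc : ∀ (x : P) (r : ℝ), 0 < r → μ (Metric.ball x (2 * r)) ≤ c * μ (Metric.ball x r))
    (hγ : γ + γ ≤ 1) (hδ : δ * c ^ 3 ≤ γ) (hN : μ N = 0) (hs : 0 < s)
    (hf0 : ∀ x, 0 ≤ f x) (hf1 : ∀ x, f x ≤ 1) (hg : ∀ x, 0 ≤ g x)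
    (hfg : ∀ x ∉ N, ∀ y ∉ N, f x ≤ f y + dist x y ^ s * (g x + g y))
    {x z p : P} {l ρ : ℝ} (hl : PortionBound μ δ g x l)
    (hρ : 0 < ρ) (hρ1 : ρ < 1 / 4) (hz : dist z x < 3 * ρ) (hp : p ∉ N) :
    |upperQuantile μ γ f (Metric.ball z ρ) - f p| ≤ (dist p z + ρ) ^ s * (g p + l) := by
  refine abs_upperQuantile_sub_le hγ (hμ.ball_lt_top z ρ hρ).ne hf0 hf1
    (lt_of_le_of_lt (measure_mono ?_) (measure_exceptional_lt hc hδ hN hl hρ hρ1 hz))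
  rintro y ⟨hy, hyK⟩
  refine ⟨hy, ?_⟩
  by_contra! hcon
  refine hyK ?_
  have hd : dist p y ^ s * (g p + g y) ≤ (dist p z + ρ) ^ s * (g p + l) := by
    have h1 : dist p y ≤ dist p z + ρ := by
      have := dist_triangle p z y
      have h2 : dist y z < ρ := hy
      rw [dist_comm z y] at this
      linarith
    have := hg p
    have := hg y
    gcongr
    exact hcon.2
  have h1 := hfg p hp y hcon.1
  have h2 := hfg y hcon.1 p hp
  rw [dist_comm y p, add_comm (g y)] at h2
  exact abs_le.2 ⟨by linarith, by linarith⟩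

theorem mul_rpow_le_mul {a ρ s : ℝ} (ha : 1 ≤ a) (hρ : 0 ≤ ρ) (hs1 : s ≤ 1) :
    (a * ρ) ^ s ≤ a * ρ ^ s := by
  rw [Real.mul_rpow (by linarith) hρ]
  gcongr
  calc a ^ s ≤ a ^ (1 : ℝ) := Real.rpow_le_rpow_of_exponent_le ha hs1
    _ = a := Real.rpow_one a

theorem quantileDrop_le (hμ : IsDoublingMeasure μ)
    (hc : ∀ (x : P) (r : ℝ), 0 < r → μ (Metric.ball x (2 * r)) ≤ c * μ (Metric.ball x r))
    (hγ : γ + γ ≤ 1) (hδ : δ * c ^ 3 ≤ γ) (hN : μ N = 0) (hs : 0 < s) (hs1 : s ≤ 1)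
    (hf0 : ∀ x, 0 ≤ f x) (hf1 : ∀ x, f x ≤ 1) (hg : ∀ x, 0 ≤ g x)
    (hfg : ∀ x ∉ N, ∀ y ∉ N, f x ≤ f y + dist x y ^ s * (g x + g y))
    {x z : P} {l ρ : ℝ} (hl : PortionBound μ δ g x l)
    (hρ : 0 < ρ) (hρ1 : ρ < 1 / 4) (hz : dist z x < ρ) :
    quantileDrop μ γ f ρ z ≤ 20 * (ρ ^ s * l) := by
  -- a point of `B(z, ρ)` outside the exceptional set, to which both quantiles are compared
  obtain ⟨p, hpz, hp⟩ : ∃ p ∈ Metric.ball z ρ, ¬ (p ∈ N ∨ l < g p) := by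
    by_contra! hcon
    have hsub : Metric.ball z ρ ⊆ {y | y ∈ Metric.ball z ρ ∧ (y ∈ N ∨ l < g y)} :=
      fun y hy => ⟨hy, hcon y hy⟩
    exact lt_irrefl (μ (Metric.ball z ρ)) ((measure_mono hsub).trans_lt
      ((measure_exceptional_lt hc hδ hN hl hρ hρ1 (by linarith)).trans_le
        ((mul_le_mul_left (le_self_add.trans hγ) _).trans_eq (one_mul _))))
  rw [not_or, not_lt] at hp
  have hl0 := hl.1
  have hpz' : dist p z < ρ := hpz
  refine Real.sSup_le ?_ (by positivity)
  rintro _ ⟨z', hz', rfl⟩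
  have hz'' : dist z' z < 2 * ρ := hz'
  have hz'x := dist_triangle z' z x
  have h1 := abs_upperQuantile_sub_point_le hμ hc hγ hδ hN hs hf0 hf1 hg hfg hl hρ hρ1
    (show dist z x < 3 * ρ by linarith) hp.1
  have h2 := abs_upperQuantile_sub_point_le hμ hc hγ hδ hN hs hf0 hf1 hg hfg hl hρ hρ1
    (show dist z' x < 3 * ρ by linarith) hp.1
  have hpz'' := dist_triangle p z z'
  rw [dist_comm z z'] at hpz''
  have e1 : (dist p z + ρ) ^ s * (g p + l) ≤ 2 * ρ ^ s * (l + l) := by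
    have := hg p
    refine mul_le_mul ?_ (by linarith [hp.2]) (by linarith) (by positivity)
    refine le_trans ?_ (mul_rpow_le_mul (a := 2) (by norm_num) hρ.le hs1)
    gcongr
    linarith
  have e2 : (dist p z' + ρ) ^ s * (g p + l) ≤ 8 * ρ ^ s * (l + l) := by
    have := hg p
    refine mul_le_mul ?_ (by linarith [hp.2]) (by linarith) (by positivity)
    refine le_trans ?_ (mul_rpow_le_mul (a := 8) (by norm_num) hρ.le hs1)
    gcongr
    linarith
  rw [abs_le] at h1 h2
  simp only
  linarith [h1.2, h2.1]

theorem upperQuantile_le_add (hμ : IsDoublingMeasure μ)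
    (hc : ∀ (x : P) (r : ℝ), 0 < r → μ (Metric.ball x (2 * r)) ≤ c * μ (Metric.ball x r))
    (hγ : γ + γ ≤ 1) (hδ : δ * c ^ 3 ≤ γ) (hN : μ N = 0) (hs : 0 < s) (hs1 : s ≤ 1)
    (hf0 : ∀ x, 0 ≤ f x) (hf1 : ∀ x, f x ≤ 1) (hg : ∀ x, 0 ≤ g x)
    (hfg : ∀ x ∉ N, ∀ y ∉ N, f x ≤ f y + dist x y ^ s * (g x + g y))
    {x z : P} {l ρ : ℝ} (hl : PortionBound μ δ g x l)
    (hρ : 0 < ρ) (hρ1 : ρ < 1 / 4) (hz : dist x z < ρ) (hx : x ∉ N) :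
    upperQuantile μ γ f (Metric.ball z ρ) ≤ f x + 2 * ρ ^ s * (g x + l) := by
  have h := abs_upperQuantile_sub_point_le hμ hc hγ hδ hN hs hf0 hf1 hg hfg hl hρ hρ1
    (show dist z x < 3 * ρ by rw [dist_comm]; linarith) hx
  have e1 : (dist x z + ρ) ^ s * (g x + l) ≤ 2 * ρ ^ s * (g x + l) := by
    have := hg x
    have := hl.1
    gcongr
    refine le_trans ?_ (mul_rpow_le_mul (a := 2) (by norm_num) hρ.le hs1)
    gcongr
    linarith
  linarith [(abs_le.1 h).2]

theorem quantileMaximal_le_add (hμ : IsDoublingMeasure μ)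
    (hc : ∀ (x : P) (r : ℝ), 0 < r → μ (Metric.ball x (2 * r)) ≤ c * μ (Metric.ball x r))
    (hγ : γ + γ ≤ 1) (hδ : δ * c ^ 3 ≤ γ) (hN : μ N = 0) (hs : 0 < s) (hs1 : s ≤ 1)
    (hf0 : ∀ x, 0 ≤ f x) (hf1 : ∀ x, f x ≤ 1) (hg : ∀ x, 0 ≤ g x)
    (hfg : ∀ x ∉ N, ∀ y ∉ N, f x ≤ f y + dist x y ^ s * (g x + g y))
    {x : P} {l : ℝ} (hl : PortionBound μ δ g x l) (hx : x ∉ N) :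
    quantileMaximal μ γ f x ≤ f x + 2 * (g x + l) := by
  have := hg x
  have := hl.1
  have := hf0 x
  refine Real.iSup_le ?_ (by positivity)
  rintro ⟨⟨ρ, hρ, hρ1⟩, z⟩
  by_cases hz : dist x z < ρ
  · refine (quantileCone_le hρ z x).trans ((upperQuantile_le_add hμ hc hγ hδ hN hs hs1 hf0 hf1 hg
      hfg hl hρ hρ1 hz hx).trans ?_)
    have : ρ ^ s ≤ 1 := Real.rpow_le_one hρ.le (by linarith) hs.le
    have : ρ ^ s * (g x + l) ≤ 1 * (g x + l) := by gcongr
    linarith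
  · simp only [quantileCone, if_neg hz]
    positivity

/-- Up to a constant, the sum of a gradient `g` of `f` and of the median maximal function of `g` is
a gradient of the quantile maximal function of `f`. For points closer than the radius of a cone this is the
bound for the slope of the cone; for other points the quantiles are compared with `f`. -/
theorem quantileMaximal_le_quantileMaximal_add (hμ : IsDoublingMeasure μ)
    (hc : ∀ (x : P) (r : ℝ), 0 < r → μ (Metric.ball x (2 * r)) ≤ c * μ (Metric.ball x r))
    (hγ : γ + γ ≤ 1) (hδ : δ * c ^ 3 ≤ γ) (hN : μ N = 0) (hs : 0 < s) (hs1 : s ≤ 1)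
    (hf0 : ∀ x, 0 ≤ f x) (hf1 : ∀ x, f x ≤ 1) (hg : ∀ x, 0 ≤ g x)
    (hfg : ∀ x ∉ N, ∀ y ∉ N, f x ≤ f y + dist x y ^ s * (g x + g y))
    {x x' : P} {l l' : ℝ} (hl : PortionBound μ δ g x l) (hl' : PortionBound μ δ g x' l')
    (hx : x ∉ N) (hx' : x' ∉ N) :
    quantileMaximal μ γ f x ≤
      quantileMaximal μ γ f x' + 20 * (dist x x' ^ s * (g x + l + (g x' + l'))) := by
  have gx := hg x
  have gx' := hg x'
  have l0 := hl.1
  have l0' := hl'.1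
  have hnn : 0 ≤ quantileMaximal μ γ f x' := quantileMaximal_nonneg x'
  have hds : 0 ≤ dist x x' ^ s := by positivity
  refine Real.iSup_le ?_ (by positivity)
  rintro ⟨⟨ρ, hρ, hρ1⟩, z⟩
  simp only
  by_cases hz : dist x z < ρ
  · rcases lt_or_ge (dist x x') ρ with hd | hd
    · have hD := quantileDrop_le hμ hc hγ hδ hN hs hs1 hf0 hf1 hg hfg hl hρ hρ1
        (show dist z x < ρ by rwa [dist_comm])
      have hD0 := quantileDrop_nonneg (μ := μ) (γ := γ) (f := f) hρ z
      -- the ratio `t` of the distance and the radius is at most `t ^ s`, as `t ≤ 1`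
      have hDd : quantileDrop μ γ f ρ z * (dist x x' / ρ) ≤ 20 * (dist x x' ^ s * l) := by
        have ht : dist x x' / ρ ≤ (dist x x' / ρ) ^ s := by
          have h1 : dist x x' / ρ ≤ 1 := (div_le_one hρ).2 hd.le
          exact Real.self_le_rpow_of_le_one (by positivity) h1 hs1
        calc quantileDrop μ γ f ρ z * (dist x x' / ρ)
            ≤ 20 * (ρ ^ s * l) * (dist x x' / ρ) ^ s := by gcongr
          _ = 20 * (dist x x' ^ s * l) := by
              rw [Real.div_rpow dist_nonneg hρ.le]
              field_simp
      have hle : 20 * (dist x x' ^ s * l) ≤ 20 * (dist x x' ^ s * (g x + l + (g x' + l'))) := by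
        gcongr
        linarith
      have htri : dist x' z / ρ ≤ dist x z / ρ + dist x x' / ρ := by
        rw [← add_div]
        gcongr
        have := dist_triangle x' x z
        rw [dist_comm x' x] at this
        linarith
      have htri' := mul_le_mul_of_nonneg_left htri hD0
      rw [mul_add] at htri'
      rw [quantileCone, if_pos hz]
      refine max_le (by positivity) ?_
      by_cases hz' : dist x' z < ρ
      · have h1 := quantileCone_le_quantileMaximal (μ := μ) (γ := γ) (f := f) hρ hρ1 z x'
        rw [quantileCone, if_pos hz'] at h1
        have h2 := (le_max_right _ _).trans h1
        linarith
      · have h1 := upperQuantile_le_quantileMaximal (μ := μ) (γ := γ) (f := f) hρ hρ1 x'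
        have h2 : dist x' z < 2 * ρ := by
          have := dist_triangle x' x z
          rw [dist_comm x' x] at this
          linarith
        have h3 := sub_le_quantileDrop (μ := μ) (γ := γ) (f := f) h2
        have h4 : quantileDrop μ γ f ρ z * 1 ≤ quantileDrop μ γ f ρ z * (dist x' z / ρ) := by
          gcongr
          rw [one_le_div hρ]
          exact not_lt.1 hz'
        linarith
    · have h1 := (quantileCone_le hρ z x).trans (upperQuantile_le_add hμ hc hγ hδ hN hs hs1 hf0
        hf1 hg hfg hl hρ hρ1 hz hx)
      have h2 := hfg x hx x' hx'
      have h3 := abs_upperQuantile_sub_point_le hμ hc hγ hδ hN hs hf0 hf1 hg hfg hl' hρ hρ1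
        (show dist x' x' < 3 * ρ by rw [dist_self]; linarith) hx'
      rw [dist_self, zero_add] at h3
      have h4 := upperQuantile_le_quantileMaximal (μ := μ) (γ := γ) (f := f) hρ hρ1 x'
      have hρs : ρ ^ s ≤ dist x x' ^ s := by gcongr
      have h5 : ρ ^ s * (g x + l) ≤ dist x x' ^ s * (g x + l) := by gcongr
      have h6 : ρ ^ s * (g x' + l') ≤ dist x x' ^ s * (g x' + l') := by gcongr
      have p1 : 0 ≤ dist x x' ^ s * g x := by positivity
      have p2 : 0 ≤ dist x x' ^ s * g x' := by positivity
      have p3 : 0 ≤ dist x x' ^ s * l := by positivity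
      have p4 : 0 ≤ dist x x' ^ s * l' := by positivity
      have h7 := (abs_le.1 h3).1
      simp only [mul_add] at *
      linarith
  · rw [quantileCone, if_neg hz]
    positivity

end gradient

/-! ### Localization -/

section cutoff

variable {P : Type*} [MetricSpace P]

/-- A Lipschitz cutoff function: `1` on `B(x₀, R)` and `0` outside `B(x₀, 2 * R)`. -/
noncomputable def ballCutoff (x₀ : P) (R : ℝ) (x : P) : ℝ≥0∞ :=
  ENNReal.ofReal (min 1 (2 - dist x x₀ / R))

theorem ballCutoff_le_one (x₀ : P) (R : ℝ) (x : P) : ballCutoff x₀ R x ≤ 1 := by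
  rw [ballCutoff, ← ENNReal.ofReal_one]
  exact ENNReal.ofReal_le_ofReal (min_le_left _ _)

theorem ballCutoff_eq_one {x₀ : P} {R : ℝ} (hR : 0 < R) {x : P} (hx : x ∈ Metric.ball x₀ R) :
    ballCutoff x₀ R x = 1 := by
  rw [ballCutoff, min_eq_left, ENNReal.ofReal_one]
  have : dist x x₀ / R ≤ 1 := (div_le_one hR).2 (le_of_lt hx)
  linarith

theorem ballCutoff_eq_zero {x₀ : P} {R : ℝ} (hR : 0 < R) {x : P}
    (hx : x ∉ Metric.ball x₀ (2 * R)) : ballCutoff x₀ R x = 0 := by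
  rw [ballCutoff, ENNReal.ofReal_eq_zero]
  refine (min_le_right _ _).trans ?_
  rw [Metric.mem_ball, not_lt] at hx
  have : 2 ≤ dist x x₀ / R := (le_div_iff₀ hR).2 hx
  linarith

theorem measurable_ballCutoff [MeasurableSpace P] [OpensMeasurableSpace P] (x₀ : P) (R : ℝ) :
    Measurable (ballCutoff x₀ R) := by
  refine (ENNReal.continuous_ofReal.comp ?_).measurable
  fun_prop

theorem ballCutoff_le_add {s : ℝ} (hs : 0 < s) (hs1 : s ≤ 1) {x₀ : P} {R : ℝ} (hR : 1 ≤ R)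
    (x y : P) : ballCutoff x₀ R x ≤ ballCutoff x₀ R y + ENNReal.ofReal (dist x y ^ s) := by
  rcases le_total 1 (dist x y) with h | h
  · refine (ballCutoff_le_one x₀ R x).trans (le_add_left ?_)
    rw [← ENNReal.ofReal_one]
    exact ENNReal.ofReal_le_ofReal (Real.one_le_rpow h hs.le)
  · have h1 : dist x y ≤ dist x y ^ s := Real.self_le_rpow_of_le_one dist_nonneg h hs1
    have h2 : dist y x₀ / R ≤ dist x x₀ / R + dist x y := by
      have h3 : dist y x₀ ≤ dist x x₀ + dist x y := by
        have := dist_triangle y x x₀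
        rw [dist_comm y x] at this
        linarith
      calc dist y x₀ / R ≤ (dist x x₀ + dist x y) / R := by gcongr
        _ = dist x x₀ / R + dist x y / R := add_div _ _ _
        _ ≤ _ := by gcongr; exact div_le_self dist_nonneg hR
    refine (ENNReal.ofReal_le_ofReal ?_).trans ENNReal.ofReal_add_le
    rcases min_cases 1 (2 - dist y x₀ / R) with h3 | h3
    · have : 0 ≤ dist x y ^ s := by positivity
      linarith [min_le_left 1 (2 - dist x x₀ / R)]
    · linarith [min_le_right 1 (2 - dist x x₀ / R)]

/-- The Leibniz rule for the product with a cutoff function. Everything is needed on the ball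
`B(x₀, 2 * R)` only. -/
theorem hasPosGradient_ballCutoff_mul [MeasurableSpace P] {μ : Measure P} {s : ℝ} (hs : 0 < s)
    (hs1 : s ≤ 1) {x₀ : P} {R : ℝ} (hR : 1 ≤ R) {v G H : P → ℝ≥0∞} (hG : AEMeasurable G μ)
    (hH : AEMeasurable H μ) {N : Set P} (hN : μ N = 0)
    (hv : ∀ x ∈ Metric.ball x₀ (2 * R) \ N, ∀ y ∈ Metric.ball x₀ (2 * R) \ N,
      v x ≤ v y + ENNReal.ofReal (dist x y ^ s) * (G x + G y))
    (hvH : ∀ x ∈ Metric.ball x₀ (2 * R) \ N, v x ≤ H x) :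
    HasPosGradient μ s (fun x => ballCutoff x₀ R x * v x) (fun x => G x + H x) := by
  have hR0 : 0 < R := by linarith
  refine ⟨hG.add hH, N, hN, fun x hx y hy => ?_⟩
  by_cases hxB : x ∈ Metric.ball x₀ (2 * R)
  · by_cases hyB : y ∈ Metric.ball x₀ (2 * R)
    · set D := ENNReal.ofReal (dist x y ^ s)
      calc ballCutoff x₀ R x * v x
          ≤ ballCutoff x₀ R x * (v y + D * (G x + G y)) := by
            gcongr; exact hv x ⟨hxB, hx⟩ y ⟨hyB, hy⟩
        _ = ballCutoff x₀ R x * v y + ballCutoff x₀ R x * (D * (G x + G y)) := mul_add _ _ _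
        _ ≤ (ballCutoff x₀ R y + D) * v y + 1 * (D * (G x + G y)) := by
            gcongr
            · exact ballCutoff_le_add hs hs1 hR x y
            · exact ballCutoff_le_one _ _ _
        _ = ballCutoff x₀ R y * v y + (D * (G x + G y) + D * v y) := by ring
        _ ≤ ballCutoff x₀ R y * v y + (D * (G x + G y) + D * (H x + H y)) := by
            gcongr
            exact (hvH y ⟨hyB, hy⟩).trans le_add_self
        _ = _ := by ring
    · calc ballCutoff x₀ R x * v x
          ≤ (ballCutoff x₀ R y + ENNReal.ofReal (dist x y ^ s)) * v x := by
            gcongr; exact ballCutoff_le_add hs hs1 hR x y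
        _ = ENNReal.ofReal (dist x y ^ s) * v x := by
            rw [ballCutoff_eq_zero hR0 hyB, zero_add]
        _ ≤ ENNReal.ofReal (dist x y ^ s) * (G x + H x + (G y + H y)) := by
            gcongr
            exact (hvH x ⟨hxB, hx⟩).trans (le_add_right le_add_self)
        _ ≤ _ := le_add_self
  · simp only [ballCutoff_eq_zero hR0 hxB, zero_mul]
    exact zero_le

end cutoff

section

variable {P : Type*} [MetricSpace P] [MeasurableSpace P] [BorelSpace P] {μ : Measure P}
  {X : QuasiBanachFunctionSpace μ} {s : ℝ}

/-- A function in the homogeneous Hajłasz space is locally in the Hajłasz space: on a ball it is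
bounded by a constant plus a multiple of its gradient. -/
theorem MemHomHajlasz.exists_gradient_ballCutoff_mul_abs (hμ : IsDoublingMeasure μ) (hs : 0 < s)
    (hs1 : s ≤ 1) {u : P → EReal} (hu : MemHomHajlasz X s u) (x₀ : P) {R : ℝ} (hR : 1 ≤ R) :
    ∃ G, HasPosGradient μ s (fun x => ballCutoff x₀ R x * (u x).abs) G ∧
      X.posNorm (fun x => ballCutoff x₀ R x * (u x).abs) < ∞ ∧ X.posNorm G < ∞ := by
  have hR0 : 0 < R := by linarith
  obtain ⟨c, -, hc⟩ := X.exists_posNorm_add_le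
  obtain ⟨g, ⟨hgm, N, hN, hg⟩, hgn⟩ := exists_posNorm_gradient_lt hu.1.2 hu.2
  have hgf := (QuasiBanachFunctionSpace.isL0_of_posNorm_lt_top hgn).2
  obtain ⟨y, hyB, hyN, hyg, hyu⟩ : ∃ y ∈ Metric.ball x₀ (2 * R), y ∉ N ∧ g y ≠ ⊤ ∧
      (u y).abs ≠ ⊤ := by
    by_contra! hcon
    refine (hμ.ball_pos x₀ (2 * R) (by linarith)).ne' (measure_mono_null ?_
      (measure_union_null hN (measure_union_null hgf hu.1.2)))
    intro y hy
    by_contra hy2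
    simp only [mem_union, not_or, mem_compl_iff, mem_ofPred_eq, not_not] at hy2
    exact EReal.abs_ne_top_iff.2 hy2.2.2 (hcon y hy hy2.1 hy2.2.1)
  set D : ℝ≥0 := Real.toNNReal ((4 * R) ^ s) with hD
  lift g y to ℝ≥0 using hyg with gy hgy
  lift (u y).abs to ℝ≥0 using hyu with uy huy
  set H : P → ℝ≥0∞ := fun x =>
    ((uy + D * gy : ℝ≥0) : ℝ≥0∞) * (Metric.ball x₀ (2 * R)).indicator (fun _ => 1) x + D * g x
    with hH
  have hHm : AEMeasurable H μ := ((aemeasurable_const.indicator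
    Metric.isOpen_ball.measurableSet).const_mul _).add (hgm.const_mul _)
  have hle : ∀ x ∈ Metric.ball x₀ (2 * R) \ N, (u x).abs ≤ H x := by
    rintro x ⟨hxB, hxN⟩
    have hd : ENNReal.ofReal (dist x y ^ s) ≤ D := by
      refine ENNReal.ofReal_le_ofReal ?_
      have h1 : dist x x₀ < 2 * R := hxB
      have h2 : dist y x₀ < 2 * R := hyB
      have h3 := dist_triangle_right x y x₀
      gcongr
      linarith
    calc (u x).abs ≤ (u y).abs + ENNReal.ofReal (dist x y ^ s) * (g x + g y) := hg x hxN y hyN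
      _ ≤ uy + D * (g x + gy) := by rw [← huy, ← hgy]; gcongr
      _ = H x := by
          simp only [hH, indicator_of_mem hxB]
          push_cast
          ring
  have hHn : X.posNorm H < ∞ := by
    have h1 : X.posNorm ((Metric.ball x₀ (2 * R)).indicator fun _ => 1) < ∞ := by
      have := X.qnorm_indicator_lt_top _
        (Metric.isOpen_ball (x := x₀) (ε := 2 * R)).measurableSet.nullMeasurableSet
        (hμ.ball_lt_top x₀ (2 * R) (by linarith))
      refine lt_of_eq_of_lt ?_ this
      unfold QuasiBanachFunctionSpace.posNorm
      congr 1
      ext x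
      by_cases hx : x ∈ Metric.ball x₀ (2 * R)
      · simp only [indicator_of_mem hx]; rfl
      · simp only [indicator_of_notMem hx]; rfl
    refine (hc _ _).trans_lt (ENNReal.mul_lt_top ENNReal.coe_lt_top (ENNReal.add_lt_top.2 ⟨?_, ?_⟩))
    · exact (QuasiBanachFunctionSpace.posNorm_mul_le _ _).trans_lt
        (ENNReal.mul_lt_top ENNReal.coe_lt_top h1)
    · exact (QuasiBanachFunctionSpace.posNorm_mul_le _ _).trans_lt
        (ENNReal.mul_lt_top ENNReal.coe_lt_top hgn)
  refine ⟨fun x => g x + H x, hasPosGradient_ballCutoff_mul hs hs1 hR hgm hHm hN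
    (fun x hx y hy => hg x hx.2 y hy.2) hle, ?_, ?_⟩
  · refine (QuasiBanachFunctionSpace.posNorm_mono ((measurable_ballCutoff x₀ R).aemeasurable.mul
      (EReal.measurable_abs.comp_aemeasurable hu.1.1)) ?_).trans_lt hHn
    filter_upwards [measure_eq_zero_iff_ae_notMem.1 hN] with x hx
    change ballCutoff x₀ R x * (u x).abs ≤ H x
    by_cases hxB : x ∈ Metric.ball x₀ (2 * R)
    · calc ballCutoff x₀ R x * (u x).abs ≤ 1 * H x :=
            mul_le_mul' (ballCutoff_le_one _ _ _) (hle x ⟨hxB, hx⟩)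
        _ = H x := one_mul _
    · rw [ballCutoff_eq_zero hR0 hxB, zero_mul]
      exact zero_le
  · exact (hc _ _).trans_lt (ENNReal.mul_lt_top ENNReal.coe_lt_top (ENNReal.add_lt_top.2 ⟨hgn, hHn⟩))

end

/-! ### A capacitary weak type estimate -/

theorem portionBound_of_medianMaximal_abs_lt {P : Type*} [MetricSpace P] [MeasurableSpace P]
    {μ : Measure P} {δ : ℝ} {G : P → ℝ≥0∞} {x : P} {l : ℝ}
    (hfin : (medianMaximal μ δ 1 (fun y => (G y : EReal)) x).abs ≠ ⊤)
    (hl : (medianMaximal μ δ 1 (fun y => (G y : EReal)) x).abs.toReal < l) :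
    PortionBound μ (ENNReal.ofReal δ) (fun y => (G y).toReal) x l := by
  have hl0 : 0 < l := ENNReal.toReal_nonneg.trans_lt hl
  refine ⟨hl0.le, fun r hr hr1 => ?_⟩
  have h1 : gammaMedian μ δ (fun y => ((G y : EReal).abs : EReal)) (Metric.ball x r)
      ≤ medianMaximal μ δ 1 (fun y => (G y : EReal)) x :=
    le_iSup₂_of_le r ⟨hr, hr1⟩ le_rfl
  have h2 : gammaMedian μ δ (fun y => ((G y : EReal).abs : EReal)) (Metric.ball x r) < l := by
    refine (h1.trans (EReal.le_coe_abs _)).trans_lt ?_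
    have h3 := (ENNReal.lt_ofReal_iff_toReal_lt hfin).2 hl
    rw [← EReal.coe_ennreal_lt_coe_ennreal_iff, EReal.coe_ennreal_ofReal, max_eq_left hl0.le] at h3
    exact h3
  obtain ⟨_, ⟨a, ha, rfl⟩, hal⟩ := sInf_lt_iff.1 h2
  refine lt_of_le_of_lt (measure_mono ?_) ha
  rintro y ⟨hy, hyl⟩
  refine ⟨hy, hal.trans ?_⟩
  simp only [EReal.abs_coe_ennreal]
  have hGy : G y ≠ ⊤ := by
    intro h
    simp only [h, ENNReal.toReal_top] at hyl
    linarith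
  have h3 := (ENNReal.ofReal_lt_iff_lt_toReal hl0.le hGy).2 hyl
  rw [← EReal.coe_ennreal_lt_coe_ennreal_iff, EReal.coe_ennreal_ofReal, max_eq_left hl0.le] at h3
  exact h3

theorem min_one_toReal_le_add {a b k : ℝ≥0∞} (hk : k ≠ ⊤) (h : a ≤ b + k) :
    (min a 1).toReal ≤ (min b 1).toReal + k.toReal := by
  have hb : min b 1 ≠ ⊤ := ne_top_of_le_ne_top ENNReal.one_ne_top (min_le_right _ _)
  rw [← ENNReal.toReal_add hb hk]
  refine ENNReal.toReal_mono (ENNReal.add_ne_top.2 ⟨hb, hk⟩) ?_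
  rcases le_total b 1 with h1 | h1
  · rw [min_eq_left h1]
    exact (min_le_left _ _).trans h
  · rw [min_eq_right h1]
    exact (min_le_right _ _).trans le_self_add

section

variable {P : Type*} [MetricSpace P] [MeasurableSpace P] [BorelSpace P] {μ : Measure P}
  {X : QuasiBanachFunctionSpace μ} {s : ℝ}

/-- The capacitary weak type estimate: the set of the centres of small balls that meet the set
`{T ≥ 1}` in a fixed portion has, locally, capacity at most a multiple of the norm of `T`. The test
function is the quantile maximal function of `min T 1`. -/
theorem exists_hajlaszCapacity_portion_le (hμ : IsDoublingMeasure μ)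
    (hM : ∀ γ : ℝ, 0 < γ → γ < 1 → ∀ (x₀ : P) (r₀ : ℝ), 0 < r₀ →
      ∃ C : ℝ≥0, ∀ g : P → EReal, X.qnorm g < ∞ →
        X.qnorm ((Metric.ball x₀ r₀).indicator (medianMaximal μ γ 1 g)) ≤ C * X.qnorm g)
    (hs : 0 < s) (hs1 : s ≤ 1) {θ : ℝ} (hθ : 0 < θ) (hθ1 : θ ≤ 1) (x₀ : P) {R : ℝ} (hR : 1 ≤ R) :
    ∃ C : ℝ≥0, ∀ (U : Set P) (T G : P → ℝ≥0∞), (∀ x ∈ U, 1 ≤ T x) → HasPosGradient μ s T G →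
      X.posNorm T + X.posNorm G < ∞ →
      hajlaszCapacity X s {x | x ∈ Metric.ball x₀ R ∧ ∃ r : ℝ, 0 < r ∧ r < 1 / 8 ∧
        ENNReal.ofReal θ * μ (Metric.ball x r) ≤ μ (Metric.ball x r ∩ U)}
      ≤ C * (X.posNorm T + X.posNorm G) := by
  have hR0 : 0 < R := by linarith
  obtain ⟨c, hc1, hc⟩ := hμ.exists_one_le
  obtain ⟨a, -, ha⟩ := X.exists_posNorm_add_le
  have hc1' : (1 : ℝ) ≤ c := by exact_mod_cast hc1
  set γ : ℝ := θ / (2 * (c * c)) with hγdef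
  set δ : ℝ := γ / c ^ 3 with hδdef
  have hγ0 : 0 < γ := by positivity
  have hγc : γ * (c * c) = θ / 2 := by rw [hγdef]; field_simp
  have hγ1 : γ ≤ 1 / 2 := by
    have : γ * 1 ≤ γ * (c * c) := by gcongr; nlinarith
    linarith
  have hδ0 : 0 < δ := by positivity
  have hδc : δ * c ^ 3 = γ := by rw [hδdef]; field_simp
  have hδ1 : δ < 1 := by
    have : δ * 1 ≤ δ * c ^ 3 := by gcongr; exact one_le_pow₀ hc1'
    linarith
  have hγE : ENNReal.ofReal γ + ENNReal.ofReal γ ≤ 1 := by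
    rw [← ENNReal.ofReal_add hγ0.le hγ0.le, ← ENNReal.ofReal_one]
    exact ENNReal.ofReal_le_ofReal (by linarith)
  have hδE : ENNReal.ofReal δ * (c : ℝ≥0∞) ^ 3 ≤ ENNReal.ofReal γ := by
    rw [← hδc, ENNReal.ofReal_mul hδ0.le, ENNReal.ofReal_pow c.coe_nonneg,
      ENNReal.ofReal_coe_nnreal]
  have hγθ : ENNReal.ofReal γ * ((c : ℝ≥0∞) * c) ≤ ENNReal.ofReal θ := by
    rw [← ENNReal.ofReal_coe_nnreal, ← ENNReal.ofReal_mul c.coe_nonneg,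
      ← ENNReal.ofReal_mul hγ0.le, hγc]
    exact ENNReal.ofReal_le_ofReal (by linarith)
  obtain ⟨Cm, hCm⟩ := hM δ hδ0 hδ1 x₀ (2 * R) (by linarith)
  refine ⟨a * (1 + 20 * (a * (1 + Cm)))
    + a * (20 * (a * (1 + Cm)) + a * (1 + 20 * (a * (1 + Cm)))),
    fun U T G hTU hTG hfin => ?_⟩
  set K := X.posNorm T + X.posNorm G with hK
  have hTn : X.posNorm T < ∞ := le_self_add.trans_lt hfin
  have hGn : X.posNorm G < ∞ := le_add_self.trans_lt hfin
  have hTm := (QuasiBanachFunctionSpace.isL0_of_posNorm_lt_top hTn).1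
  obtain ⟨hGm, hGf⟩ := QuasiBanachFunctionSpace.isL0_of_posNorm_lt_top hGn
  set M : P → ℝ≥0∞ := fun x => ((Metric.ball x₀ (2 * R)).indicator
    (medianMaximal μ δ 1 fun y => (G y : EReal)) x).abs with hMdef
  have hMn : X.posNorm M ≤ Cm * X.posNorm G :=
    (QuasiBanachFunctionSpace.posNorm_abs_le _).trans (hCm _ hGn)
  obtain ⟨hMm, hMf⟩ := QuasiBanachFunctionSpace.isL0_of_posNorm_lt_top
    (hMn.trans_lt (ENNReal.mul_lt_top ENNReal.coe_lt_top hGn))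
  obtain ⟨-, N₀, hN₀, hTG⟩ := hTG
  set N : Set P := N₀ ∪ ({x | ¬ G x ≠ ⊤} ∪ {x | ¬ M x ≠ ⊤}) with hNdef
  have hN : μ N = 0 := measure_union_null hN₀ (measure_union_null hGf hMf)
  have hNmem : ∀ x ∉ N, x ∉ N₀ ∧ G x ≠ ⊤ ∧ M x ≠ ⊤ := by
    intro x hx
    simpa only [hNdef, mem_union, not_or, mem_ofPred_eq, not_not] using hx
  set f : P → ℝ := fun x => (min (T x) 1).toReal with hf
  set g : P → ℝ := fun x => (G x).toReal with hg
  have hf0 : ∀ x, 0 ≤ f x := fun x => ENNReal.toReal_nonneg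
  have hf1 : ∀ x, f x ≤ 1 := fun x =>
    ENNReal.toReal_le_of_le_ofReal zero_le_one (by simp)
  have hg0 : ∀ x, 0 ≤ g x := fun x => ENNReal.toReal_nonneg
  have hfU : ∀ x ∈ U, 1 ≤ f x := fun x hx => by
    simp only [hf]
    rw [min_eq_right (hTU x hx), ENNReal.toReal_one]
  have hfg : ∀ x ∉ N, ∀ y ∉ N, f x ≤ f y + dist x y ^ s * (g x + g y) := by
    intro x hx y hy
    obtain ⟨hx0, hxG, -⟩ := hNmem x hx
    obtain ⟨hy0, hyG, -⟩ := hNmem y hy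
    refine (min_one_toReal_le_add ?_ (hTG x hx0 y hy0)).trans_eq ?_
    · exact ENNReal.mul_ne_top ENNReal.ofReal_ne_top (ENNReal.add_ne_top.2 ⟨hxG, hyG⟩)
    · rw [ENNReal.toReal_mul, ENNReal.toReal_ofReal (by positivity), ENNReal.toReal_add hxG hyG]
  have hPB : ∀ x ∈ Metric.ball x₀ (2 * R) \ N, ∀ l : ℝ, (M x).toReal < l →
      PortionBound μ (ENNReal.ofReal δ) g x l := by
    rintro x ⟨hxB, hxN⟩ l hl
    have h1 := (hNmem x hxN).2.2
    simp only [hMdef, indicator_of_mem hxB] at h1 hl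
    exact portionBound_of_medianMaximal_abs_lt h1 hl
  set h : P → ℝ := quantileMaximal μ (ENNReal.ofReal γ) f with hh
  have hh0 : ∀ x, 0 ≤ h x := quantileMaximal_nonneg
  set G₁ : P → ℝ≥0∞ := fun x => ((20 : ℝ≥0) : ℝ≥0∞) * (G x + M x) with hG₁
  set H : P → ℝ≥0∞ := fun x => T x + G₁ x with hH
  have hG₁m : AEMeasurable G₁ μ := (hGm.add hMm).const_mul _
  have hHm : AEMeasurable H μ := hTm.add hG₁m
  have hG₁r : ∀ x ∉ N, G₁ x = ENNReal.ofReal (20 * (g x + (M x).toReal)) := by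
    intro x hx
    obtain ⟨-, hxG, hxM⟩ := hNmem x hx
    simp only [hG₁, hg]
    rw [ENNReal.ofReal_mul (by norm_num), ENNReal.ofReal_add ENNReal.toReal_nonneg
      ENNReal.toReal_nonneg, ENNReal.ofReal_toReal hxG, ENNReal.ofReal_toReal hxM]
    norm_num
  have hvG : ∀ x ∈ Metric.ball x₀ (2 * R) \ N, ∀ y ∈ Metric.ball x₀ (2 * R) \ N,
      ENNReal.ofReal (h x) ≤ ENNReal.ofReal (h y)
        + ENNReal.ofReal (dist x y ^ s) * (G₁ x + G₁ y) := by
    intro x hx y hy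
    have hgx := hg0 x
    have hgy := hg0 y
    have key : h x ≤ h y + 20 * (dist x y ^ s * (g x + (M x).toReal + (g y + (M y).toReal))) := by
      have hlim : Tendsto (fun e : ℝ => h y + 20 * (dist x y ^ s *
          (g x + ((M x).toReal + e) + (g y + ((M y).toReal + e))))) (𝓝[>] 0)
          (𝓝 (h y + 20 * (dist x y ^ s *
            (g x + ((M x).toReal + 0) + (g y + ((M y).toReal + 0)))))) := by
        refine Tendsto.mono_left (Continuous.tendsto ?_ 0) nhdsWithin_le_nhds
        fun_prop
      simp only [add_zero] at hlim
      refine ge_of_tendsto hlim ?_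
      filter_upwards [self_mem_nhdsWithin] with e he
      have he' : 0 < e := he
      exact quantileMaximal_le_quantileMaximal_add hμ hc hγE hδE hN hs hs1 hf0 hf1 hg0 hfg
        (hPB x hx _ (by linarith)) (hPB y hy _ (by linarith)) hx.2 hy.2
    rw [hG₁r x hx.2, hG₁r y hy.2, ← ENNReal.ofReal_add (by positivity) (by positivity),
      ← ENNReal.ofReal_mul (by positivity), ← ENNReal.ofReal_add (hh0 y) (by positivity)]
    exact ENNReal.ofReal_le_ofReal (key.trans_eq (by ring))
  have hvH : ∀ x ∈ Metric.ball x₀ (2 * R) \ N, ENNReal.ofReal (h x) ≤ H x := by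
    intro x hx
    have hgx := hg0 x
    have hMx : 0 ≤ (M x).toReal := ENNReal.toReal_nonneg
    have key : h x ≤ f x + 2 * (g x + (M x).toReal) := by
      have hlim : Tendsto (fun e : ℝ => f x + 2 * (g x + ((M x).toReal + e))) (𝓝[>] 0)
          (𝓝 (f x + 2 * (g x + ((M x).toReal + 0)))) := by
        refine Tendsto.mono_left (Continuous.tendsto ?_ 0) nhdsWithin_le_nhds
        fun_prop
      simp only [add_zero] at hlim
      refine ge_of_tendsto hlim ?_
      filter_upwards [self_mem_nhdsWithin] with e he
      have he' : 0 < e := he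
      exact quantileMaximal_le_add hμ hc hγE hδE hN hs hs1 hf0 hf1 hg0 hfg
        (hPB x hx _ (by linarith)) hx.2
    calc ENNReal.ofReal (h x) ≤ ENNReal.ofReal (f x + 20 * (g x + (M x).toReal)) :=
          ENNReal.ofReal_le_ofReal (by linarith)
      _ ≤ ENNReal.ofReal (f x) + ENNReal.ofReal (20 * (g x + (M x).toReal)) :=
          ENNReal.ofReal_add_le
      _ ≤ T x + G₁ x := by
          rw [hG₁r x hx.2]
          gcongr
          exact ENNReal.ofReal_toReal_le.trans (min_le_left _ _)
  have hgrad := hasPosGradient_ballCutoff_mul hs hs1 hR hG₁m hHm hN hvG hvH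
  set V : Set P := Metric.ball x₀ R ∩ ⋃ (x : P) (r : ℝ) (_ : 0 < r ∧ r < 1 / 8 ∧
    ENNReal.ofReal θ * μ (Metric.ball x r) ≤ μ (Metric.ball x r ∩ U)), Metric.ball x r with hV
  have hVo : IsOpen V := Metric.isOpen_ball.inter
    (isOpen_iUnion fun x => isOpen_iUnion fun r => isOpen_iUnion fun _ => Metric.isOpen_ball)
  refine (hajlaszCapacity_le hgrad hVo ?_ ?_).trans ?_
  · rintro x ⟨hxB, r, hr⟩
    refine ⟨hxB, ?_⟩
    simp only [mem_iUnion]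
    exact ⟨x, r, hr, Metric.mem_ball_self hr.1⟩
  · rintro y ⟨hyB, hy⟩
    simp only [mem_iUnion] at hy
    obtain ⟨x, r, ⟨hr, hr1, hrU⟩, hyr⟩ := hy
    rw [ballCutoff_eq_one hR0 hyB, one_mul, ← ENNReal.ofReal_one]
    exact ENNReal.ofReal_le_ofReal (one_le_quantileMaximal hc hγθ hfU hr hr1 hrU hyr)
  · have hG₁n : X.posNorm G₁ ≤ ((20 * (a * (1 + Cm)) : ℝ≥0) : ℝ≥0∞) * K :=
      calc X.posNorm G₁ ≤ (20 : ℝ≥0) * X.posNorm (fun x => G x + M x) :=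
            QuasiBanachFunctionSpace.posNorm_mul_le _ _
        _ ≤ (20 : ℝ≥0) * (a * (X.posNorm G + Cm * X.posNorm G)) := by
            gcongr
            exact (ha _ _).trans (by gcongr)
        _ ≤ (20 : ℝ≥0) * (a * (K + Cm * K)) := by
            gcongr <;> exact le_add_self
        _ = _ := by push_cast; ring
    have hHn : X.posNorm H ≤ ((a * (1 + 20 * (a * (1 + Cm))) : ℝ≥0) : ℝ≥0∞) * K :=
      calc X.posNorm H ≤ a * (X.posNorm T + X.posNorm G₁) := ha _ _
        _ ≤ a * (K + ((20 * (a * (1 + Cm)) : ℝ≥0) : ℝ≥0∞) * K) := by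
            gcongr
            exact le_self_add
        _ = _ := by push_cast; ring
    have h1 : X.posNorm (fun x => ballCutoff x₀ R x * ENNReal.ofReal (h x)) ≤ X.posNorm H := by
      refine QuasiBanachFunctionSpace.posNorm_mono ((measurable_ballCutoff x₀ R).mul
        (ENNReal.measurable_ofReal.comp measurable_quantileMaximal)).aemeasurable ?_
      filter_upwards [measure_eq_zero_iff_ae_notMem.1 hN] with x hx
      by_cases hxB : x ∈ Metric.ball x₀ (2 * R)
      · calc ballCutoff x₀ R x * ENNReal.ofReal (h x) ≤ 1 * H x :=
              mul_le_mul' (ballCutoff_le_one _ _ _) (hvH x ⟨hxB, hx⟩)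
          _ = H x := one_mul _
      · rw [ballCutoff_eq_zero hR0 hxB, zero_mul]
        exact zero_le
    calc _ ≤ X.posNorm H + a * (X.posNorm G₁ + X.posNorm H) := add_le_add h1 (ha _ _)
      _ ≤ ((a * (1 + 20 * (a * (1 + Cm))) : ℝ≥0) : ℝ≥0∞) * K
          + a * (((20 * (a * (1 + Cm)) : ℝ≥0) : ℝ≥0∞) * K
            + ((a * (1 + 20 * (a * (1 + Cm))) : ℝ≥0) : ℝ≥0∞) * K) := by gcongr
      _ = _ := by push_cast; ring

end

/-! ### Limits of medians -/

section

variable {P : Type*} [MetricSpace P] [MeasurableSpace P] {μ : Measure P}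

/-- The portion of the small balls centred at `x` where `|u - u x|` is greater than `a` is less
than `θ`. -/
def SmallDeviation (μ : Measure P) (u : P → EReal) (x : P) (θ : ℝ) : Prop :=
  ∀ a : ℝ, 0 < a → ∀ᶠ r : ℝ in 𝓝[>] 0,
    μ {y | y ∈ Metric.ball x r ∧ (a : EReal) < ((u y - u x).abs : EReal)}
      < ENNReal.ofReal θ * μ (Metric.ball x r)

theorem SmallDeviation.mono {u : P → EReal} {x : P} {θ θ' : ℝ} (h : SmallDeviation μ u x θ)
    (hθ : θ ≤ θ') : SmallDeviation μ u x θ' := by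
  intro a ha
  filter_upwards [h a ha] with r hr
  exact hr.trans_le (by gcongr)

theorem EReal.lt_coe_abs_sub_coe {v : EReal} {t e : ℝ}
    (h : v < (t - e : ℝ) ∨ ((t + e : ℝ) : EReal) < v) : (e : EReal) < ((v - t).abs : EReal) := by
  induction v with
  | bot => simp
  | top => simp
  | coe v =>
    rw [← EReal.coe_sub, EReal.coe_abs]
    norm_cast at h ⊢
    rcases h with h | h
    · exact lt_of_lt_of_le (by linarith) (neg_le_abs _)
    · exact lt_of_lt_of_le (by linarith) (le_abs_self _)

theorem SmallDeviation.tendsto_gammaMedian_abs_sub {u : P → EReal} {x : P} {γ : ℝ}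
    (hγ1 : γ < 1) (h : SmallDeviation μ u x γ) :
    Tendsto (fun r : ℝ => gammaMedian μ γ (fun y => ((u y - u x).abs : EReal)) (Metric.ball x r))
      (𝓝[>] 0) (𝓝 0) := by
  refine tendsto_order.2 ⟨fun b hb => ?_, fun b hb => ?_⟩
  · filter_upwards [self_mem_nhdsWithin] with r hr
    refine hb.trans_le (le_sInf ?_)
    rintro _ ⟨a, ha, rfl⟩
    by_contra hlt
    rw [not_le] at hlt
    have hset : {y | y ∈ Metric.ball x r ∧ (a : EReal) < ((u y - u x).abs : EReal)}
        = Metric.ball x r := by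
      ext y
      exact ⟨fun hy => hy.1, fun hy => ⟨hy, hlt.trans_le (EReal.coe_ennreal_nonneg _)⟩⟩
    rw [mem_ofPred_eq, hset] at ha
    refine lt_irrefl _ (ha.trans_le ?_)
    calc ENNReal.ofReal γ * μ (Metric.ball x r) ≤ 1 * μ (Metric.ball x r) := by
          gcongr
          rw [← ENNReal.ofReal_one]
          exact ENNReal.ofReal_le_ofReal hγ1.le
      _ = _ := one_mul _
  · obtain ⟨a, ha0, hab⟩ := EReal.lt_iff_exists_real_btwn.1 hb
    filter_upwards [h a (by exact_mod_cast ha0)] with r hr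
    exact lt_of_le_of_lt (sInf_le (mem_image_of_mem _ hr)) hab

theorem SmallDeviation.tendsto_gammaMedian {u : P → EReal} {x : P} {γ : ℝ}
    (hγ0 : 0 < γ) (hγ1 : γ < 1) (hux : u x ≠ ⊤ ∧ u x ≠ ⊥)
    (h : SmallDeviation μ u x γ) (h' : SmallDeviation μ u x (1 - γ)) :
    Tendsto (fun r : ℝ => gammaMedian μ γ u (Metric.ball x r)) (𝓝[>] 0) (𝓝 (u x)) := by
  obtain ⟨t, ht⟩ : ∃ t : ℝ, u x = t := ⟨_, (EReal.coe_toReal hux.1 hux.2).symm⟩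
  unfold SmallDeviation at h h'
  rw [ht] at h h' ⊢
  refine tendsto_order.2 ⟨fun b hb => ?_, fun b hb => ?_⟩
  · obtain ⟨a, hba, hat⟩ := EReal.lt_iff_exists_real_btwn.1 hb
    have hat' : a < t := by exact_mod_cast hat
    filter_upwards [h' (t - a) (by linarith), self_mem_nhdsWithin] with r hr hr0
    have hr0' : 0 < r := hr0
    refine hba.trans_le (le_sInf ?_)
    rintro _ ⟨d, hd, rfl⟩
    by_contra hlt
    rw [not_le] at hlt
    have hsub : Metric.ball x r ⊆ {y | y ∈ Metric.ball x r ∧ (d : EReal) < u y} ∪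
        {y | y ∈ Metric.ball x r ∧ ((t - a : ℝ) : EReal) < ((u y - t).abs : EReal)} := by
      intro y hy
      rcases lt_or_ge (d : EReal) (u y) with hdy | hdy
      · exact Or.inl ⟨hy, hdy⟩
      · refine Or.inr ⟨hy, EReal.lt_coe_abs_sub_coe (Or.inl ?_)⟩
        rw [sub_sub_cancel]
        exact hdy.trans_lt hlt
    refine lt_irrefl (μ (Metric.ball x r)) ?_
    calc μ (Metric.ball x r) ≤ _ := (measure_mono hsub).trans (measure_union_le _ _)
      _ < ENNReal.ofReal γ * μ (Metric.ball x r) + ENNReal.ofReal (1 - γ) * μ (Metric.ball x r) :=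
          ENNReal.add_lt_add hd hr
      _ = μ (Metric.ball x r) := by
          rw [← add_mul, ← ENNReal.ofReal_add hγ0.le (by linarith), add_sub_cancel,
            ENNReal.ofReal_one, one_mul]
  · obtain ⟨a, hta, hab⟩ := EReal.lt_iff_exists_real_btwn.1 hb
    have hta' : t < a := by exact_mod_cast hta
    filter_upwards [h (a - t) (by linarith)] with r hr
    refine lt_of_le_of_lt (sInf_le (mem_image_of_mem _
      (lt_of_le_of_lt (measure_mono ?_) hr))) hab
    rintro y ⟨hy, hay⟩
    refine ⟨hy, EReal.lt_coe_abs_sub_coe (Or.inr ?_)⟩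
    rwa [add_sub_cancel]

/-- If `u` is continuous off `E` and a superset `U` of `E` has portion less than `θ` in all small
balls centred at `x`, then `u` has deviation less than `θ` at `x`. -/
theorem smallDeviation_of_continuousOn {u : P → EReal} {E U : Set P} (hEU : E ⊆ U)
    (hu : ContinuousOn u Eᶜ) {x : P} (hxE : x ∉ E) (hux : u x ≠ ⊤ ∧ u x ≠ ⊥) {θ r₀ : ℝ}
    (hr₀ : 0 < r₀) (h : ∀ r : ℝ, 0 < r → r < r₀ →
      μ (Metric.ball x r ∩ U) < ENNReal.ofReal θ * μ (Metric.ball x r)) :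
    SmallDeviation μ u x θ := by
  intro a ha
  obtain ⟨t, ht⟩ : ∃ t : ℝ, u x = t := ⟨_, (EReal.coe_toReal hux.1 hux.2).symm⟩
  have hI : Ioo ((t - a : ℝ) : EReal) ((t + a : ℝ) : EReal) ∈ 𝓝 (u x) := by
    rw [ht]
    refine Ioo_mem_nhds ?_ ?_
    · exact_mod_cast (by linarith : t - a < t)
    · exact_mod_cast (by linarith : t < t + a)
  obtain ⟨r₁, hr₁, hball⟩ := Metric.mem_nhdsWithin_iff.1 (hu x hxE hI)
  filter_upwards [Ioo_mem_nhdsGT (lt_min hr₀ hr₁)] with r hr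
  refine lt_of_le_of_lt (measure_mono ?_) (h r hr.1 (hr.2.trans_le (min_le_left _ _)))
  rintro y ⟨hy, hya⟩
  refine ⟨hy, ?_⟩
  by_contra hyU
  have hyI := hball ⟨Metric.ball_subset_ball (hr.2.le.trans (min_le_right _ _)) hy,
    fun hyE => hyU (hEU hyE)⟩
  rw [mem_preimage] at hyI
  rw [ht] at hya
  refine absurd hya (not_lt.2 ?_)
  generalize u y = v at hyI
  induction v with
  | bot => simp at hyI
  | top => simp at hyI
  | coe v =>
    rw [← EReal.coe_sub, EReal.coe_abs]
    simp only [mem_Ioo] at hyI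
    norm_cast at hyI ⊢
    exact (abs_sub_le_iff.2 ⟨by linarith [hyI.2], by linarith [hyI.1]⟩)

end

/-! ### The exceptional set -/

section

variable {P : Type*} [MetricSpace P] [MeasurableSpace P] [BorelSpace P] {μ : Measure P}
  {X : QuasiBanachFunctionSpace μ} {s : ℝ}

/-- A quasicontinuous function of the homogeneous Hajłasz space is finite outside a set of
capacity zero. -/
theorem hajlaszCapacity_setOf_abs_eq_top (hμ : IsDoublingMeasure μ) (hs : 0 < s) (hs1 : s ≤ 1)
    {u : P → EReal} (hu : MemHomHajlasz X s u) (huq : IsQuasicontinuous X s u) (x₀ : P) {R : ℝ}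
    (hR : 1 ≤ R) : hajlaszCapacity X s {x | x ∈ Metric.ball x₀ R ∧ (u x).abs = ⊤} = 0 := by
  have hR0 : 0 < R := by linarith
  obtain ⟨c, -, hc⟩ := X.exists_posNorm_add_le
  obtain ⟨G, hG, hun, hGn⟩ := hu.exists_gradient_ballCutoff_mul_abs hμ hs hs1 x₀ hR
  set v : P → ℝ≥0∞ := fun x => ballCutoff x₀ R x * (u x).abs with hv
  have key : ∀ δ : ℝ≥0, 0 < δ → hajlaszCapacity X s {x | x ∈ Metric.ball x₀ R ∧ (u x).abs = ⊤} ≤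
      c * (δ * X.posNorm v + δ) + c * (δ * X.posNorm G + δ) := by
    intro δ hδ
    obtain ⟨E, hE, hEc⟩ := huq δ (by exact_mod_cast hδ)
    obtain ⟨U, T, G', hU, hEU, hT1, hTG, hTn⟩ := exists_test_of_hajlaszCapacity_lt hE
    obtain ⟨O, hO, hOE⟩ := continuousOn_iff'.1 hEc
      (Iio ((-(δ : ℝ)⁻¹ : ℝ) : EReal) ∪ Ioi (((δ : ℝ)⁻¹ : ℝ) : EReal)) (isOpen_Iio.union isOpen_Ioi)
    refine (hajlaszCapacity_le ((hG.const_mul δ).add hTG)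
      ((hO.union hU).inter (Metric.isOpen_ball (x := x₀) (ε := R))) ?_ ?_).trans ?_
    · rintro x ⟨hxB, hx⟩
      refine ⟨?_, hxB⟩
      by_cases hxE : x ∈ E
      · exact Or.inr (hEU hxE)
      · refine Or.inl (hOE.subset ⟨?_, hxE⟩).1
        rw [mem_preimage]
        generalize u x = w at hx
        induction w with
        | bot => exact Or.inl (EReal.bot_lt_coe _)
        | top => exact Or.inr (EReal.coe_lt_top _)
        | coe w => exact absurd hx (EReal.abs_coe_lt_top w).ne
    · rintro x ⟨hx, hxB⟩
      by_cases hxU : x ∈ U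
      · exact (hT1 x hxU).trans le_add_self
      · have hxO : x ∈ O := hx.resolve_right hxU
        have hx2 := (hOE.superset ⟨hxO, fun hxE => hxU (hEU hxE)⟩).1
        refine le_trans ?_ le_self_add
        rw [hv]
        simp only
        rw [ballCutoff_eq_one hR0 hxB, one_mul]
        rw [mem_preimage] at hx2
        have hδ0 : (δ : ℝ≥0∞) ≠ 0 := by simpa using hδ.ne'
        generalize u x = w at hx2
        induction w with
        | bot => simp [ENNReal.mul_top hδ0]
        | top => simp [ENNReal.mul_top hδ0]
        | coe w =>
          have hw : (δ : ℝ)⁻¹ ≤ |w| := by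
            rcases hx2 with h | h
            · have h' : w < -(δ : ℝ)⁻¹ := EReal.coe_lt_coe_iff.1 h
              exact le_trans (by linarith) (neg_le_abs w)
            · have h' : (δ : ℝ)⁻¹ < w := EReal.coe_lt_coe_iff.1 h
              exact h'.le.trans (le_abs_self w)
          have hδ' : 0 < (δ : ℝ) := hδ
          rw [EReal.abs_def, ← ENNReal.ofReal_coe_nnreal, ← ENNReal.ofReal_mul δ.coe_nonneg,
            ← ENNReal.ofReal_one]
          refine ENNReal.ofReal_le_ofReal ?_
          calc (1 : ℝ) = δ * (δ : ℝ)⁻¹ := (mul_inv_cancel₀ hδ'.ne').symm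
            _ ≤ δ * |w| := by gcongr
    · refine add_le_add ((hc _ _).trans ?_) ((hc _ _).trans ?_)
      · gcongr
        · exact QuasiBanachFunctionSpace.posNorm_mul_le _ _
        · exact le_self_add.trans hTn.le
      · gcongr
        · exact QuasiBanachFunctionSpace.posNorm_mul_le _ _
        · exact le_add_self.trans hTn.le
  have hlim : Tendsto (fun δ : ℝ≥0 => c * ((δ : ℝ≥0∞) * X.posNorm v + δ)
      + c * (δ * X.posNorm G + δ)) (𝓝[>] 0) (𝓝 0) := by
    have h0 : Tendsto (fun δ : ℝ≥0 => (δ : ℝ≥0∞)) (𝓝[>] 0) (𝓝 0) :=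
      (ENNReal.tendsto_coe.2 tendsto_id).mono_left nhdsWithin_le_nhds
    have h1 := ENNReal.Tendsto.const_mul ((ENNReal.Tendsto.mul_const h0 (Or.inr hun.ne)).add h0)
      (Or.inr (ENNReal.coe_ne_top (r := c)))
    have h2 := ENNReal.Tendsto.const_mul ((ENNReal.Tendsto.mul_const h0 (Or.inr hGn.ne)).add h0)
      (Or.inr (ENNReal.coe_ne_top (r := c)))
    simpa using h1.add h2
  refine le_antisymm (ge_of_tendsto hlim ?_) zero_le
  filter_upwards [self_mem_nhdsWithin] with δ hδ using key δ hδ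

/-- Outside a set of capacity zero, a quasicontinuous function has small deviation. -/
theorem hajlaszCapacity_setOf_not_smallDeviation (hμ : IsDoublingMeasure μ)
    (hM : ∀ γ : ℝ, 0 < γ → γ < 1 → ∀ (x₀ : P) (r₀ : ℝ), 0 < r₀ →
      ∃ C : ℝ≥0, ∀ g : P → EReal, X.qnorm g < ∞ →
        X.qnorm ((Metric.ball x₀ r₀).indicator (medianMaximal μ γ 1 g)) ≤ C * X.qnorm g)
    (hs : 0 < s) (hs1 : s ≤ 1) {u : P → EReal} (huq : IsQuasicontinuous X s u) {θ : ℝ}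
    (hθ : 0 < θ) (hθ1 : θ ≤ 1) (x₀ : P) {R : ℝ} (hR : 1 ≤ R) :
    hajlaszCapacity X s {x | x ∈ Metric.ball x₀ R ∧ (u x).abs ≠ ⊤ ∧ ¬ SmallDeviation μ u x θ}
      = 0 := by
  obtain ⟨C, hC⟩ := exists_hajlaszCapacity_portion_le hμ hM hs hs1 hθ hθ1 x₀ hR
  have key : ∀ δ : ℝ≥0, 0 < δ → hajlaszCapacity X s
      {x | x ∈ Metric.ball x₀ R ∧ (u x).abs ≠ ⊤ ∧ ¬ SmallDeviation μ u x θ} ≤ C * δ := by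
    intro δ hδ
    obtain ⟨E, hE, hEc⟩ := huq δ (by exact_mod_cast hδ)
    obtain ⟨U, T, G, hU, hEU, hT1, hTG, hTn⟩ := exists_test_of_hajlaszCapacity_lt hE
    refine (hajlaszCapacity_mono ?_).trans ((hC U T G hT1 hTG (hTn.trans_le le_top)).trans
      (by gcongr))
    rintro x ⟨hxB, hux, hxD⟩
    refine ⟨hxB, ?_⟩
    by_contra! hcon
    -- a point of the open set `U` is the centre of a ball contained in `U`
    have hxU : x ∉ U := by
      intro hxU
      obtain ⟨r, hr, hrU⟩ := Metric.isOpen_iff.1 hU x hxU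
      have hr' : 0 < min r (1 / 16) := lt_min hr (by norm_num)
      have h1 := hcon (min r (1 / 16)) hr' ((min_le_right _ _).trans_lt (by norm_num))
      rw [inter_eq_left.2 ((Metric.ball_subset_ball (min_le_left _ _)).trans hrU)] at h1
      refine lt_irrefl _ (h1.trans_le ?_)
      calc _ ≤ 1 * μ (Metric.ball x (min r (1 / 16))) := by
            gcongr
            rw [← ENNReal.ofReal_one]
            exact ENNReal.ofReal_le_ofReal hθ1
        _ = _ := one_mul _
    exact hxD (smallDeviation_of_continuousOn hEU hEc (fun hxE => hxU (hEU hxE))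
      (EReal.abs_ne_top_iff.1 hux) (r₀ := 1 / 8) (by norm_num) hcon)
  have hlim : Tendsto (fun δ : ℝ≥0 => (C : ℝ≥0∞) * δ) (𝓝[>] 0) (𝓝 0) := by
    have h0 : Tendsto (fun δ : ℝ≥0 => (δ : ℝ≥0∞)) (𝓝[>] 0) (𝓝 0) :=
      (ENNReal.tendsto_coe.2 tendsto_id).mono_left nhdsWithin_le_nhds
    simpa using ENNReal.Tendsto.const_mul h0 (Or.inr (ENNReal.coe_ne_top (r := C)))
  refine le_antisymm (ge_of_tendsto hlim ?_) zero_le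
  filter_upwards [self_mem_nhdsWithin] with δ hδ using key δ hδ

end

theorem theorem1p1 {P : Type*} [MetricSpace P] [MeasurableSpace P] [BorelSpace P]
    (μ : Measure P) (hμ : IsDoublingMeasure μ)
    (X : QuasiBanachFunctionSpace μ) (hX : X.AbsolutelyContinuous)
    (hM : ∀ γ : ℝ, 0 < γ → γ < 1 → ∀ (x₀ : P) (r₀ : ℝ), 0 < r₀ →
      ∃ C : ℝ≥0, ∀ g : P → EReal, X.qnorm g < ∞ →
        X.qnorm ((Metric.ball x₀ r₀).indicator (medianMaximal μ γ 1 g)) ≤ C * X.qnorm g)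
    (s : ℝ) (hs₀ : 0 < s) (hs₁ : s ≤ 1)
    (u : P → EReal) (hu : MemHomHajlasz X s u) (huq : IsQuasicontinuous X s u) :
    ∃ E : Set P, hajlaszCapacity X s E = 0 ∧
      ∀ x ∉ E, ∀ γ : ℝ, 0 < γ → γ < 1 →
        Tendsto (fun r : ℝ =>
            gammaMedian μ γ (fun y => ((u y - u x).abs : EReal)) (Metric.ball x r))
          (𝓝[>] 0) (𝓝 0) ∧
        Tendsto (fun r : ℝ => gammaMedian μ γ u (Metric.ball x r)) (𝓝[>] 0) (𝓝 (u x)) := by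
  rcases isEmpty_or_nonempty P with hP | ⟨⟨x₀⟩⟩
  · exact ⟨∅, hajlaszCapacity_empty, fun x => hP.elim x⟩
  have hR : ∀ i : ℕ, (1 : ℝ) ≤ i + 1 := fun i => by
    have : (0 : ℝ) ≤ i := i.cast_nonneg
    linarith
  refine ⟨⋃ i : ℕ, ({x | x ∈ Metric.ball x₀ (i + 1) ∧ (u x).abs = ⊤} : Set P) ∪
    ⋃ k : ℕ, {x | x ∈ Metric.ball x₀ (i + 1) ∧ (u x).abs ≠ ⊤ ∧
      ¬ SmallDeviation μ u x (1 / (k + 1))}, ?_, ?_⟩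
  · refine hajlaszCapacity_iUnion_eq_zero fun i => ?_
    rw [union_eq_iUnion]
    refine hajlaszCapacity_iUnion_eq_zero fun b => ?_
    cases b
    · refine hajlaszCapacity_iUnion_eq_zero fun k => ?_
      have hk : (0 : ℝ) < k + 1 := by positivity
      refine hajlaszCapacity_setOf_not_smallDeviation hμ hM hs₀ hs₁ huq (by positivity) ?_ x₀ (hR i)
      rw [div_le_one hk]
      exact hR k
    · exact hajlaszCapacity_setOf_abs_eq_top hμ hs₀ hs₁ hu huq x₀ (hR i)
  · intro x hx γ hγ0 hγ1
    simp only [mem_iUnion, mem_union, mem_ofPred_eq, not_exists, not_or, not_and, not_not] at hx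
    obtain ⟨i, hi⟩ := exists_nat_gt (dist x x₀)
    have hxi : x ∈ Metric.ball x₀ ((i : ℝ) + 1) := by
      rw [Metric.mem_ball]
      linarith
    have hfin : (u x).abs ≠ ⊤ := (hx i).1 hxi
    have hdev : ∀ θ : ℝ, 0 < θ → SmallDeviation μ u x θ := fun θ hθ => by
      obtain ⟨k, hk⟩ := exists_nat_one_div_lt hθ
      exact ((hx i).2 k hxi hfin).mono hk.le
    exact ⟨(hdev γ hγ0).tendsto_gammaMedian_abs_sub hγ1,
      (hdev γ hγ0).tendsto_gammaMedian hγ0 hγ1 (EReal.abs_ne_top_iff.1 hfin)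
        (hdev (1 - γ) (by linarith))⟩
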